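/- Let $M$ be a smooth manifold (Hausdorff, second countable) and $E\to M$ a smooth complex vector bundle of rank $p$. Write $C^\infty(M)$ for the complex-valued smooth functions, $\Gamma(TM)$ for the derivations of $C^\infty(M)$ (complex vector fields), $\Gamma(E)$ for the smooth sections, $A(E)=\Gamma(\mathrm{End}\,E)$, and $\Omega^\bullet(M)$, $\Omega^\bullet(M,\mathrm{End}\,E)$ for the forms on $M$ with values in $C^\infty(M)$ and in $A(E)$. Let $\mathfrak D(E)$ be the transitive Lie algebroid of first-order operators $D$ on $\Gamma(E)$ for which there is $X=\sigma(D)\in\Gamma(TM)$ with $D(fs)=f\,Ds+X(f)\,s$, with the commutator bracket, so that $0\to A(E)\to\mathfrak D(E)\xrightarrow{\sigma}\Gamma(TM)\to 0$ is exact. Let $\Omega^k_{\mathrm{Lie}}(E,A(E))$ be the space of $C^\infty(M)$-multilinear alternating maps $\mathfrak D(E)^k\to A(E)$, with the Koszul differential $$(\hat d\omega)(D_1,\dots,D_{k+1})=\sum_i(-1)^{i+1}[D_i,\omega(\dots\widehat{D_i}\dots)]+\sum_{i<j}(-1)^{i+j}\omega([D_i,D_j],\dots\widehat{D_i}\dots\widehat{D_j}\dots),$$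 and let $d$ be the de Rham differential on $\Omega^\bullet(M)$. Equip $A(E)$ with the inner metric $h(a,b)=\mathrm{tr}(ab)$. Let $n=p^2$ and let $E_1,\dots,E_n$ be any basis of $M_p(\mathbb C)$. In a local trivialization of $E$ let $\theta^1,\dots,\theta^n$ be the dual basis and $|h|=|\det(\mathrm{tr}(E_aE_b))|$. Then: (i) For every $q\ge 0$ and $\omega\in\Omega^{q+n}_{\mathrm{Lie}}(E,A(E))$ there is a unique $\eta\in\Omega^q(M,\mathrm{End}\,E)$ which, in every local trivialization of $E$, is the factor of $\sqrt{|h|}\,\theta^1\wedge\dots\wedge\theta^n$ in $\omega$: $$\omega(D_1,\dots,D_q,a_1,\dots,a_n)=\sqrt{|h|}\,(\theta^1\wedge\dots\wedge\theta^n)(a_1,\dots,a_n)\;\eta(\sigma(D_1),\dots,\sigma(D_q))$$ for all $D_i\in\mathfrak D(E)$ and $a_j\in A(E)$, where $(\theta^1\wedge\dots\wedge\theta^n)(a_1,\dots,a_n)=\det(\theta^i(a_j))$. Put $\int_{\mathrm{inner}}\omega=\eta$, and let $\int_{\mathrm{inner}}$ be $0$ on forms of degree $<n$. (ii) With $\int^{\mathrm{tr}}_{\mathrm{inner}}=\mathrm{tr}\circ\int_{\mathrm{inner}}:\Omega^{\bullet}_{\mathrm{Lie}}(E,A(E))\to\Omega^{\bullet-n}(M)$,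 for all $\omega\in\Omega^\bullet_{\mathrm{Lie}}(E,A(E))$ $$\int^{\mathrm{tr}}_{\mathrm{inner}}\hat d\omega=d\int^{\mathrm{tr}}_{\mathrm{inner}}\omega .$$ In particular $\int^{\mathrm{tr}}_{\mathrm{inner}}\hat d\omega=0$ if $\omega$ has degree $n-1$. -/

import Mathlib

open scoped Manifold ContDiff Bundle
open Bundle

/-! ### Forms on a Lie–Rinehart algebra and the Koszul differential -/

section Koszul

set_option linter.unusedSectionVars false

/-- A representation of a Lie–Rinehart algebra `(R, L)` on an `R`-module `V`: besides being a
Lie algebra action, `x · v` is `R`-linear in `x` and satisfies the Leibniz rule in `v`. -/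
class LieRinehartRep (R L V : Type*) [CommRing R] [LieRing L] [Module R L] [LieRingModule L R]
    [AddCommGroup V] [Module R V] [LieRingModule L V] : Prop where
  smul_lie' (f : R) (x : L) (v : V) : ⁅f • x, v⁆ = f • ⁅x, v⁆
  lie_smul' (x : L) (f : R) (v : V) : ⁅x, f • v⁆ = f • ⁅x, v⁆ + ⁅x, f⁆ • v

instance LieRinehartRep.self (R L : Type*) [CommRing R] [LieRing L] [Module R L]
    [LieRingModule L R] [LieRinehartRing R L] : LieRinehartRep R L R where
  smul_lie' f x v := by simp
  lie_smul' x f v := by simp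

variable {R L V : Type*} [CommRing R] [LieRing L] [Module R L] [LieRingModule L R]
  [AddCommGroup V] [Module R V] [LieRingModule L V]

/-- The Koszul formula
`∑ i, (-1)^i [v i, α(v 0, …, v̂ i, …, v q)]
  + ∑ i < j, (-1)^(i+j) α([v i, v j], v 0, …, v̂ i, …, v̂ j, …, v q)`.
The last term is written with `[v i, v j]` left in the place of `v j`, that is as
`- (-1)^i α(v 0, …, v̂ i, …, [v i, v j], …, v q)`: moving the entry to the front
passes `j - 1` arguments. -/
def koszul {q : ℕ} (α : L [⋀^Fin q]→ₗ[R] V) (v : Fin (q + 1) → L) : V :=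
  ∑ i : Fin (q + 1), (-1 : ℤ) ^ (i : ℕ) •
    (⁅v i, α (i.removeNth v)⁆ -
      ∑ j ∈ Finset.Ioi i, α (i.removeNth (Function.update v j ⁅v i, v j⁆)))

/-- The action of `x` on the values of `α`, as a `ℤ`-multilinear alternating map. -/
def koszulAct {q : ℕ} (α : L [⋀^Fin q]→ₗ[R] V) : L →ₗ[ℤ] L [⋀^Fin q]→ₗ[ℤ] V :=
  AddMonoidHom.toIntLinearMap
    { toFun := fun x =>
        { toFun := fun u => ⁅x, α u⁆
          map_update_add' := by
            intro d u i a b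
            obtain rfl : d = instDecidableEqFin q := Subsingleton.elim _ _
            simp
          map_update_smul' := by
            intro d u i c a
            obtain rfl : d = instDecidableEqFin q := Subsingleton.elim _ _
            rw [← Int.cast_smul_eq_zsmul R c a, α.map_update_smul, Int.cast_smul_eq_zsmul, lie_zsmul]
          map_eq_zero_of_eq' := by
            intro u i j h hij
            rw [α.map_eq_zero_of_eq u h hij, lie_zero] }
      map_zero' := by ext; simp
      map_add' := by intros; ext; simp }

/-- The Lie derivative `u ↦ ∑ k, α (u 0, …, [x, u k], …)` on the arguments of `α`. -/
def koszulAd {q : ℕ} (α : L [⋀^Fin q]→ₗ[R] V) : L →ₗ[ℤ] L [⋀^Fin q]→ₗ[ℤ] V :=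
  AddMonoidHom.toIntLinearMap
    { toFun := fun x =>
        { toFun := fun u => ∑ k, α (Function.update u k ⁅x, u k⁆)
          map_update_add' := by
            intro d u i a b
            obtain rfl : d = instDecidableEqFin q := Subsingleton.elim _ _
            rw [← Finset.sum_add_distrib]
            refine Finset.sum_congr rfl fun k _ => ?_
            rcases eq_or_ne k i with rfl | h
            · simp
            · simp only [Function.update_of_ne, ne_eq, h, not_false_eq_true]
              simp only [fun y => Function.update_comm (β := fun _ => L) (Ne.symm h) y ⁅x, u k⁆ u]
              rw [α.map_update_add]
          map_update_smul' := by
            intro d u i c a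
            obtain rfl : d = instDecidableEqFin q := Subsingleton.elim _ _
            rw [Finset.smul_sum]
            refine Finset.sum_congr rfl fun k _ => ?_
            rcases eq_or_ne k i with rfl | h
            · simp only [Function.update_self, Function.update_idem, lie_zsmul]
              rw [← Int.cast_smul_eq_zsmul R c, α.map_update_smul, Int.cast_smul_eq_zsmul]
            · simp only [Function.update_of_ne, ne_eq, h, not_false_eq_true]
              simp only [fun y => Function.update_comm (β := fun _ => L) (Ne.symm h) y ⁅x, u k⁆ u]
              rw [← Int.cast_smul_eq_zsmul R c, α.map_update_smul, Int.cast_smul_eq_zsmul]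
          map_eq_zero_of_eq' := by
            intro u i j h hij
            rw [← Finset.sum_subset (Finset.subset_univ {i, j}), Finset.sum_pair hij]
            · have h2 : Function.update u j ⁅x, u j⁆ =
                  (Function.update u i ⁅x, u i⁆) ∘ Equiv.swap i j := by
                ext k
                rcases eq_or_ne k i with rfl | hk
                · simp [hij, hij.symm, h]
                rcases eq_or_ne k j with rfl | hk'
                · simp [h]
                · simp [Equiv.swap_apply_of_ne_of_ne hk hk', hk, hk']
              rw [h2, α.map_swap _ hij, add_neg_cancel]
            · intro k _ hk
              simp only [Finset.mem_insert, Finset.mem_singleton, not_or] at hk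
              refine α.map_eq_zero_of_eq _ (i := i) (j := j) ?_ hij
              rw [Function.update_of_ne (Ne.symm hk.1), Function.update_of_ne (Ne.symm hk.2), h] }
      map_zero' := by
        ext u
        simp only [zero_lie, AlternatingMap.coe_mk, MultilinearMap.coe_mk,
          AlternatingMap.zero_apply]
        exact Finset.sum_eq_zero fun k _ => α.map_update_zero u k
      map_add' := by
        intros; ext
        simp [Finset.sum_add_distrib] }

theorem koszul_swap {q : ℕ} (α : L [⋀^Fin q]→ₗ[R] V) (v : Fin (q + 1) → L) {i j : Fin (q + 1)}
    (h : i ≠ j) :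
    (-1 : ℤ) ^ (i : ℕ) • α (i.removeNth (Function.update v j ⁅v i, v j⁆)) =
      (-1 : ℤ) ^ (j : ℕ) • α (j.removeNth (Function.update v i ⁅v j, v i⁆)) := by
  set w := ⁅v i, v j⁆ with hw
  have key := α.neg_one_pow_smul_map_removeNth_add_eq_zero_of_eq
    (v := Function.update (Function.update v j w) i w) (i := i) (j := j) (by simp [h.symm]) h
  rw [Fin.removeNth_update, Function.update_comm h.symm, Fin.removeNth_update] at key
  rw [← lie_skew, ← hw]
  have e : α (j.removeNth (Function.update v i (-w))) = - α (j.removeNth (Function.update v i w)) := by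
    obtain ⟨k, rfl⟩ := Fin.exists_succAbove_eq h
    have : ∀ y, j.removeNth (Function.update v (j.succAbove k) y) =
        Function.update (j.removeNth v) k y := by
      intro y
      ext l
      simp [Fin.removeNth, Function.update_apply]
    rw [this, this, α.map_update_neg]
  have key' : (-1 : ℤ) ^ (i : ℕ) • α (i.removeNth (Function.update v j w)) +
    (-1 : ℤ) ^ (j : ℕ) • α (j.removeNth (Function.update v i w)) = 0 := by
    exact_mod_cast key
  rw [e, smul_neg]
  exact eq_neg_of_add_eq_zero_left key'

theorem removeNth_update_succAbove {q : ℕ} (v : Fin (q + 1) → L) (i : Fin (q + 1)) (k : Fin q)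
    (y : L) : i.removeNth (Function.update v (i.succAbove k) y) =
      Function.update (i.removeNth v) k y := by
  ext l
  simp [Fin.removeNth, Function.update_apply]

theorem two_smul_koszul {q : ℕ} (α : L [⋀^Fin q]→ₗ[R] V) (v : Fin (q + 1) → L) :
    (2 : ℤ) • koszul α v =
      AlternatingMap.alternatizeUncurryFin ((2 : ℤ) • koszulAct α - koszulAd α) v := by
  rw [AlternatingMap.alternatizeUncurryFin_apply]
  set T : Fin (q + 1) → Fin (q + 1) → V := fun i j =>
    (-1 : ℤ) ^ (i : ℕ) • α (i.removeNth (Function.update v j ⁅v i, v j⁆)) with hT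
  have h1 : ∀ i, koszulAd α (v i) (i.removeNth v) =
      ∑ j ∈ Finset.univ.erase i, α (i.removeNth (Function.update v j ⁅v i, v j⁆)) := by
    intro i
    have : Finset.univ.erase i = Finset.univ.map (Fin.succAboveEmb i) := by
      ext j
      simp [Fin.exists_succAbove_eq_iff]
    rw [this, Finset.sum_map]
    simp only [Fin.coe_succAboveEmb, removeNth_update_succAbove]
    rfl
  have h2 : ∀ i : Fin (q + 1), Finset.univ.erase i = Finset.Ioi i ∪ Finset.Iio i := by
    intro i
    ext j
    simp [lt_or_lt_iff_ne, ne_comm]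
  have h3 : ∀ i : Fin (q + 1), Disjoint (Finset.Ioi i) (Finset.Iio i) := by
    intro i
    rw [Finset.disjoint_left]
    intro j hj hj'
    simp only [Finset.mem_Ioi, Finset.mem_Iio] at hj hj'
    exact lt_asymm hj hj'
  have h4 : ∑ i, ∑ j ∈ Finset.Iio i, T i j = ∑ i, ∑ j ∈ Finset.Ioi i, T i j := by
    rw [Finset.sum_comm' (t' := Finset.univ) (s' := fun j => Finset.Ioi j) (by simp)]
    refine Finset.sum_congr rfl fun i _ => Finset.sum_congr rfl fun j hj => ?_
    exact koszul_swap α v (Finset.mem_Ioi.1 hj).ne'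
  have h5 : koszul α v = ∑ i : Fin (q + 1), (-1 : ℤ) ^ (i : ℕ) • ⁅v i, α (i.removeNth v)⁆ -
      ∑ i, ∑ j ∈ Finset.Ioi i, T i j := by
    simp only [koszul, smul_sub, Finset.sum_sub_distrib, Finset.smul_sum, hT]
  have h6 : ∑ i : Fin (q + 1), (-1 : ℤ) ^ (i : ℕ) •
      ((2 : ℤ) • koszulAct α - koszulAd α) (v i) (i.removeNth v) =
      (2 : ℤ) • ∑ i : Fin (q + 1), (-1 : ℤ) ^ (i : ℕ) • ⁅v i, α (i.removeNth v)⁆ -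
      (∑ i, ∑ j ∈ Finset.Ioi i, T i j + ∑ i, ∑ j ∈ Finset.Iio i, T i j) := by
    rw [← Finset.sum_add_distrib, Finset.smul_sum, ← Finset.sum_sub_distrib]
    refine Finset.sum_congr rfl fun i _ => ?_
    rw [← Finset.sum_union (h3 i), ← h2]
    simp only [LinearMap.sub_apply, LinearMap.smul_apply, AlternatingMap.sub_apply,
      AlternatingMap.smul_apply, h1, smul_sub, hT, Finset.smul_sum]
    rw [smul_comm]
    rfl
  rw [h6, h4, h5, smul_sub, two_smul ℤ (∑ i, ∑ j ∈ Finset.Ioi i, T i j)]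

theorem koszul_cons {q : ℕ} (α : L [⋀^Fin (q + 1)]→ₗ[R] V) (x : L) (u : Fin (q + 1) → L) :
    koszul α (Fin.cons x u) = ⁅x, α u⁆ - koszulAd α x u - koszul (α.curryLeft x) u := by
  rw [koszul, Fin.sum_univ_succ, sub_eq_add_neg _ (koszul (α.curryLeft x) u)]
  congr 1
  · simp only [Fin.val_zero, pow_zero, one_smul, Fin.cons_zero, Fin.removeNth_zero, Fin.tail_cons]
    congr 1
    have : Finset.Ioi (0 : Fin (q + 2)) = Finset.univ.map (Fin.succEmb (q + 1)) := by
      ext j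
      simp [Fin.exists_succ_eq]
    rw [this, Finset.sum_map]
    refine Finset.sum_congr rfl fun k _ => ?_
    simp
  · rw [koszul, ← Finset.sum_neg_distrib]
    have hr : ∀ (w : Fin (q + 1) → L) (i : Fin (q + 1)), i.succ.removeNth (Fin.cons x w : Fin (q + 2) → L) =
        Fin.cons x (i.removeNth w) := by
      intro w i
      ext k
      refine Fin.cases ?_ (fun k => ?_) k <;> simp [Fin.removeNth]
    refine Finset.sum_congr rfl fun i _ => ?_
    have hI : Finset.Ioi i.succ = (Finset.Ioi i).map (Fin.succEmb (q + 1)) := by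
      simp
    rw [Fin.val_succ, pow_succ, mul_neg_one, neg_smul, hI, Finset.sum_map]
    simp only [Fin.coe_succEmb, Fin.cons_succ, ← Fin.cons_update, hr]
    rfl

theorem koszul_smul {q : ℕ} [LieRinehartRep R L V] (f : R) (α : L [⋀^Fin q]→ₗ[R] V)
    (u : Fin (q + 1) → L) :
    koszul (f • α) u = f • koszul α u +
      ∑ i : Fin (q + 1), (-1 : ℤ) ^ (i : ℕ) • ⁅u i, f⁆ • α (i.removeNth u) := by
  simp only [koszul, Finset.smul_sum, ← Finset.sum_add_distrib, AlternatingMap.smul_apply]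
  refine Finset.sum_congr rfl fun i _ => ?_
  rw [LieRinehartRep.lie_smul', smul_comm f ((-1 : ℤ) ^ (i : ℕ)), ← smul_add]
  congr 1
  rw [smul_sub f, Finset.smul_sum]
  exact add_sub_right_comm _ _ _

theorem koszul_cons_smul {q : ℕ} [LieRinehartRing R L] [LieRinehartRep R L V] (f : R)
    (α : L [⋀^Fin q]→ₗ[R] V) (x : L) (u : Fin q → L) :
    koszul α (Fin.cons (f • x) u) = f • koszul α (Fin.cons x u) := by
  cases q with
  | zero =>
    simp [koszul, LieRinehartRep.smul_lie']
  | succ q =>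
    have h1 : koszulAd α (f • x) u = f • koszulAd α x u - ∑ i, ⁅u i, f⁆ • α (Function.update u i x) := by
      change ∑ i, α (Function.update u i ⁅f • x, u i⁆) = f • ∑ i, α (Function.update u i ⁅x, u i⁆) - _
      rw [Finset.smul_sum, ← Finset.sum_sub_distrib]
      refine Finset.sum_congr rfl fun i _ => ?_
      rw [← lie_skew, LieRinehartRing.leibniz_smul_right, neg_add, ← smul_neg, lie_skew,
        α.map_update_add, α.map_update_smul, ← neg_smul, α.map_update_smul, neg_smul,
        sub_eq_add_neg]
    have h2 : ∀ i : Fin (q + 1), (-1 : ℤ) ^ (i : ℕ) • ⁅u i, f⁆ • α.curryLeft x (i.removeNth u) =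
        ⁅u i, f⁆ • α (Function.update u i x) := by
      intro i
      have h3 : α (Function.update u i x) = (-1 : ℤ) ^ (i : ℕ) • α.curryLeft x (i.removeNth u) := by
        rw [← Fin.insertNth_removeNth, AlternatingMap.map_insertNth]
        rfl
      rw [h3, smul_comm]
    rw [koszul_cons, koszul_cons, LieRinehartRep.smul_lie', h1, map_smul, koszul_smul,
      Finset.sum_congr rfl fun i _ => h2 i]
    simp only [smul_sub]
    abel

variable [Module ℝ V]

theorem eq_of_two_smul_eq {v w : V} (h : (2 : ℤ) • v = (2 : ℤ) • w) : v = w := by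
  rw [← Int.cast_smul_eq_zsmul ℝ, ← Int.cast_smul_eq_zsmul ℝ] at h
  exact smul_right_injective V (by norm_num : ((2 : ℤ) : ℝ) ≠ 0) h

/-- `koszul α` is alternating over `ℤ`. -/
def koszulInt {q : ℕ} (α : L [⋀^Fin q]→ₗ[R] V) : L [⋀^Fin (q + 1)]→ₗ[ℤ] V where
  toFun := koszul α
  map_update_add' := by
    intro d u i a b
    apply eq_of_two_smul_eq
    rw [smul_add, two_smul_koszul, two_smul_koszul, two_smul_koszul,
      AlternatingMap.map_update_add]
  map_update_smul' := by
    intro d u i c a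
    apply eq_of_two_smul_eq
    rw [smul_comm (2 : ℤ) c, two_smul_koszul, two_smul_koszul, AlternatingMap.map_update_smul]
  map_eq_zero_of_eq' := by
    intro u i j h hij
    apply eq_of_two_smul_eq
    rw [smul_zero, two_smul_koszul, AlternatingMap.map_eq_zero_of_eq _ u h hij]

variable [LieRinehartRing R L] [LieRinehartRep R L V]

/-- The differential `Ω^q(L, V) → Ω^{q+1}(L, V)` of the complex of `V`-valued forms on the
Lie–Rinehart algebra `L`, given by the Koszul formula. -/
def lieDifferential {q : ℕ} (α : L [⋀^Fin q]→ₗ[R] V) : L [⋀^Fin (q + 1)]→ₗ[R] V where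
  toFun := koszul α
  map_update_add' := (koszulInt α).map_update_add'
  map_update_smul' := by
    intro d u k f x
    obtain rfl : d = instDecidableEqFin (q + 1) := Subsingleton.elim _ _
    have key : ∀ y : L, (Function.update u k y) ∘ Equiv.swap 0 k =
        (Fin.cons y (Fin.tail (u ∘ Equiv.swap 0 k)) : Fin (q + 1) → L) := by
      intro y
      ext i
      refine Fin.cases ?_ (fun i => ?_) i
      · simp
      · have : Equiv.swap 0 k i.succ ≠ k := by
          intro h
          rw [Equiv.swap_apply_eq_iff, Equiv.swap_apply_right] at h
          exact Fin.succ_ne_zero i h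
        simp [this, Fin.tail]
    have h : ∀ y : L, koszul α (Function.update u k y) = Equiv.Perm.sign (Equiv.swap 0 k) •
        koszul α (Fin.cons y (Fin.tail (u ∘ Equiv.swap 0 k)) : Fin (q + 1) → L) := by
      intro y
      rw [← key]
      have := (koszulInt α).map_perm (Function.update u k y) (Equiv.swap 0 k)
      change koszul α _ = _ • koszul α _ at this
      rw [this, smul_smul, Int.units_mul_self, one_smul]
    rw [h, h, koszul_cons_smul, smul_comm]
  map_eq_zero_of_eq' := (koszulInt α).map_eq_zero_of_eq'

end Koszul

/-! ### Smooth functions, vector fields and sections of a complex vector bundle -/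

noncomputable section Bundles

instance instContMDiffRingComplex (r : ℕ∞ω) : ContMDiffRing 𝓘(ℝ, ℂ) r ℂ where
  contMDiff_add := (contMDiff_fst (M := ℂ) (N := ℂ)).add contMDiff_snd
  contMDiff_mul :=
    (contDiff_fst.mul contDiff_snd).contMDiff.comp
      ((contMDiff_fst (M := ℂ) (N := ℂ)).prodMk_space contMDiff_snd)

/-- A complex vector bundle is a real vector bundle, with the same local trivializations. -/
instance instVectorBundleReal {B F : Type*} {E : B → Type*} [TopologicalSpace B]
    [NormedAddCommGroup F] [NormedSpace ℂ F] [TopologicalSpace (TotalSpace F E)]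
    [∀ x, TopologicalSpace (E x)] [∀ x, AddCommGroup (E x)] [∀ x, Module ℂ (E x)]
    [FiberBundle F E] [VectorBundle ℂ F E] : VectorBundle ℝ F E where
  trivialization_linear' e _ := ⟨fun b hb =>
    { map_add := (e.linear ℂ hb).map_add
      map_smul := fun c x => by
        have := (e.linear ℂ hb).map_smul (c : ℂ) x
        simpa using this }⟩
  continuousOn_coordChange' e e' he he' := by
    have : e.IsLinear ℝ := ⟨fun b hb =>
      { map_add := (e.linear ℂ hb).map_add
        map_smul := fun c x => by
          have := (e.linear ℂ hb).map_smul (c : ℂ) x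
          simpa using this }⟩
    have : e'.IsLinear ℝ := ⟨fun b hb =>
      { map_add := (e'.linear ℂ hb).map_add
        map_smul := fun c x => by
          have := (e'.linear ℂ hb).map_smul (c : ℂ) x
          simpa using this }⟩
    have h := VectorBundle.continuousOn_coordChange' (R := ℂ) e e'
    have h2 := (ContinuousLinearMap.restrictScalarsL ℂ F F ℝ ℝ).continuous.comp_continuousOn h
    refine h2.congr fun b hb => ?_
    ext v
    change e.coordChangeL ℝ e' b v = e.coordChangeL ℂ e' b v
    rw [e.coordChangeL_apply e' hb, e.coordChangeL_apply e' hb]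

variable {m : ℕ} {M : Type*} [TopologicalSpace M] [ChartedSpace (EuclideanSpace ℝ (Fin m)) M]

variable (m M) in
/-- `C^∞(M)`: the algebra of smooth complex valued functions on `M`. -/
abbrev SmoothFun := C^∞⟮𝓡 m, M; 𝓘(ℝ, ℂ), ℂ⟯

variable (m M) in
/-- `Γ(TM)`, as a `C^∞(M)`-module: the (complex) vector fields on `M`, that is the derivations of
the algebra `C^∞(M)` of complex valued functions. An `ℝ`-linear derivation kills the constant
function `i`, since `i² = -1`, so it is `ℂ`-linear. -/
abbrev VectorFields := Derivation ℝ (SmoothFun m M) (SmoothFun m M)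

variable (F : Type*) [NormedAddCommGroup F] [NormedSpace ℂ F] (E : M → Type*)
  [TopologicalSpace (TotalSpace F E)] [∀ x, TopologicalSpace (E x)]
  [∀ x, AddCommGroup (E x)] [∀ x, Module ℂ (E x)] [FiberBundle F E]

variable (m) in
/-- `Γ(E)`: the smooth sections of `E`. -/
abbrev Sections := Cₛ^∞⟮𝓡 m; F, E⟯

theorem contMDiffAt_complex_smul {f : M → ℂ} {g : M → F} {x : M}
    (hf : ContMDiffAt (𝓡 m) 𝓘(ℝ, ℂ) ∞ f x) (hg : ContMDiffAt (𝓡 m) 𝓘(ℝ, F) ∞ g x) :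
    ContMDiffAt (𝓡 m) 𝓘(ℝ, F) ∞ (fun y => f y • g y) x := by
  have h : ContDiff ℝ ∞ (fun p : ℂ × F => p.1 • p.2) :=
    (isBoundedBilinearMap_smul (𝕜 := ℝ) (A := ℂ) (E := F)).contDiff
  exact h.contMDiff.contMDiffAt.comp x (hf.prodMk_space hg)

variable [VectorBundle ℂ F E]

theorem contMDiff_complex_smul_section (f : SmoothFun m M) (s : Sections m F E) :
    ContMDiff (𝓡 m) ((𝓡 m).prod 𝓘(ℝ, F)) ∞ fun x => TotalSpace.mk' F x (f x • s x) := by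
  intro x
  rw [Bundle.contMDiffAt_section]
  have hs := (Bundle.contMDiffAt_section x).1 (s.contMDiff x)
  refine (contMDiffAt_complex_smul F f.contMDiff.contMDiffAt hs).congr_of_eventuallyEq ?_
  filter_upwards [(trivializationAt F E x).open_baseSet.mem_nhds
    (FiberBundle.mem_baseSet_trivializationAt F E x)] with y hy
  exact ((trivializationAt F E x).linear ℂ hy).map_smul _ _

instance : SMul (SmoothFun m M) (Sections m F E) where
  smul f s := ⟨fun x => f x • s x, contMDiff_complex_smul_section F E f s⟩

variable {F E} in
theorem Sections.smul_apply (f : SmoothFun m M) (s : Sections m F E) (x : M) :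
    (f • s) x = f x • s x := rfl

instance : Module (SmoothFun m M) (Sections m F E) where
  one_smul s := by ext x; exact one_smul ℂ (s x)
  mul_smul f g s := by ext x; exact mul_smul (f x) (g x) (s x)
  smul_zero f := by ext x; exact smul_zero (f x)
  smul_add f s t := by ext x; exact smul_add (f x) (s x) (t x)
  add_smul f g s := by ext x; exact add_smul (f x) (g x) (s x)
  zero_smul s := by ext x; exact zero_smul ℂ (s x)

instance : IsScalarTower ℝ (SmoothFun m M) (Sections m F E) where
  smul_assoc c f s := by
    ext x
    exact smul_assoc c (f x) (s x)

instance : SMulCommClass ℝ (SmoothFun m M) (Sections m F E) where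
  smul_comm c f s := by
    ext x
    exact smul_comm c (f x) (s x)

instance : SMulCommClass (SmoothFun m M) ℝ (Sections m F E) := SMulCommClass.symm _ _ _

/-! ### The Lie algebroid of derivations of `E` -/

variable (m) in
/-- `A(E) = Γ(End E)`, realised as the `C^∞(M)`-linear endomorphisms of `Γ(E)`; its Lie bracket is
the commutator. -/
abbrev EndSections := Module.End (SmoothFun m M) (Sections m F E)

variable (m) in
/-- The first-order differential operators on `Γ(E)` with scalar symbol: pairs of a vector field
`X` and an operator `D` on `Γ(E)` such that `D (f s) = f (D s) + X(f) s`. (`D` determines `X` as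
soon as `E` has positive rank.) -/
def derOperators : Submodule (SmoothFun m M)
    (VectorFields m M × (Sections m F E →ₗ[ℝ] Sections m F E)) where
  carrier := {D | ∀ (f : SmoothFun m M) (s : Sections m F E),
    D.2 (f • s) = f • D.2 s + D.1 f • s}
  zero_mem' := by intro f s; simp
  add_mem' := by
    intro D D' h h' f s
    simp only [Prod.snd_add, LinearMap.add_apply, h f s, h' f s, Prod.fst_add,
      Derivation.add_apply, smul_add, add_smul]
    abel
  smul_mem' := by
    intro g D h f s
    simp only [Prod.smul_snd, LinearMap.smul_apply, h f s, Prod.smul_fst, Derivation.smul_apply,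
      smul_add, smul_assoc, smul_comm g f]

variable (m) in
/-- `𝔇(E)`, the transitive Lie algebroid of derivations of `E`. -/
abbrev DerAlgebroid : Type _ := ↥(derOperators m F E)

variable {F E}

namespace DerAlgebroid

variable (m F E) in
/-- The anchor `σ : 𝔇(E) → Γ(TM)`, the symbol map. -/
def symbol : DerAlgebroid m F E →ₗ[SmoothFun m M] VectorFields m M :=
  LinearMap.fst _ _ _ ∘ₗ (derOperators m F E).subtype

variable (m F E) in
/-- The inclusion `ι : A(E) → 𝔇(E)` of the kernel of the symbol map. -/
def inclusion : EndSections m F E →ₗ[SmoothFun m M] DerAlgebroid m F E where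
  toFun a := ⟨(0, a.restrictScalars ℝ), fun f s => by
    rw [Derivation.zero_apply, zero_smul, add_zero]
    exact a.map_smul f s⟩
  map_add' a b := by
    ext1
    exact Prod.ext (add_zero 0).symm rfl
  map_smul' f a := by
    ext1
    exact Prod.ext (smul_zero f).symm rfl

/-- The operator on `Γ(E)`. -/
def op (D : DerAlgebroid m F E) : Sections m F E →ₗ[ℝ] Sections m F E := D.1.2

theorem op_smul (D : DerAlgebroid m F E) (f : SmoothFun m M) (s : Sections m F E) :
    D.op (f • s) = f • D.op s + symbol m F E D f • s := D.2 f s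

theorem ext {D D' : DerAlgebroid m F E} (h : symbol m F E D = symbol m F E D')
    (h' : D.op = D'.op) : D = D' := Subtype.ext (Prod.ext h h')

/-- The bracket is the commutator. -/
instance : Bracket (DerAlgebroid m F E) (DerAlgebroid m F E) where
  bracket D D' := ⟨(⁅symbol m F E D, symbol m F E D'⁆, D.op ∘ₗ D'.op - D'.op ∘ₗ D.op), fun f s => by
    simp only [LinearMap.sub_apply, LinearMap.comp_apply, op_smul, map_add,
      Derivation.commutator_apply, smul_sub, sub_smul]
    abel⟩

theorem symbol_bracket (D D' : DerAlgebroid m F E) :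
    symbol m F E ⁅D, D'⁆ = ⁅symbol m F E D, symbol m F E D'⁆ := rfl

theorem op_bracket (D D' : DerAlgebroid m F E) :
    op ⁅D, D'⁆ = D.op ∘ₗ D'.op - D'.op ∘ₗ D.op := rfl

theorem op_add (D D' : DerAlgebroid m F E) : op (D + D') = D.op + D'.op := rfl

instance : LieRing (DerAlgebroid m F E) where
  add_lie D D' D'' := by
    apply ext
    · simp only [symbol_bracket, map_add]
      exact LieRing.add_lie _ _ _
    · simp only [op_bracket, op_add, LinearMap.add_comp, LinearMap.comp_add]
      abel
  lie_add D D' D'' := by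
    apply ext
    · simp only [symbol_bracket, map_add]
      exact LieRing.lie_add _ _ _
    · simp only [op_bracket, op_add, LinearMap.add_comp, LinearMap.comp_add]
      abel
  lie_self D := by
    apply ext
    · rw [symbol_bracket, lie_self, map_zero]
    · exact sub_self _
  leibniz_lie D D' D'' := by
    apply ext
    · simp only [symbol_bracket, map_add]
      exact LieRing.leibniz_lie _ _ _
    · simp only [op_bracket, op_add, LinearMap.sub_comp, LinearMap.comp_sub, LinearMap.comp_assoc]
      abel

/-- `𝔇(E)` acts on functions through the symbol. -/
instance : LieRingModule (DerAlgebroid m F E) (SmoothFun m M) where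
  bracket D f := symbol m F E D f
  add_lie D D' f := rfl
  lie_add D f g := map_add _ f g
  leibniz_lie D D' f := by
    change symbol m F E D (symbol m F E D' f) = symbol m F E ⁅D, D'⁆ f +
      symbol m F E D' (symbol m F E D f)
    rw [symbol_bracket, Derivation.commutator_apply, sub_add_cancel]

theorem lie_fun (D : DerAlgebroid m F E) (f : SmoothFun m M) : ⁅D, f⁆ = symbol m F E D f := rfl

instance : LieRinehartRing (SmoothFun m M) (DerAlgebroid m F E) where
  lie_smul_eq_mul' f g D := rfl
  leibniz_mul_right' D f g := by
    simp only [lie_fun, Derivation.leibniz, smul_eq_mul]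
    ring
  leibniz_smul_right' D D' f := by
    apply ext
    · simp only [symbol_bracket, map_add, map_smul]
      exact LieRinehartRing.leibniz_smul_right (symbol m F E D) (symbol m F E D') f
    · ext1 s
      change D.op (f • D'.op s) - f • D'.op (D.op s) =
        f • (D.op (D'.op s) - D'.op (D.op s)) + symbol m F E D f • D'.op s
      rw [op_smul, smul_sub]
      abel

/-- The adjoint representation of `𝔇(E)` on its kernel: `[D, a] = D ∘ a - a ∘ D`. -/
instance : LieRingModule (DerAlgebroid m F E) (EndSections m F E) where
  bracket D a :=
    { toFun := fun s => D.op (a s) - a (D.op s)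
      map_add' := fun s t => by
        simp only [map_add]
        abel
      map_smul' := fun f s => by
        simp only [map_smul, map_add, op_smul, RingHom.id_apply, smul_sub]
        abel }
  add_lie D D' a := by
    ext1 s
    change (D.op (a s) + D'.op (a s)) - a (D.op s + D'.op s) =
      (D.op (a s) - a (D.op s)) + (D'.op (a s) - a (D'.op s))
    rw [map_add]
    abel
  lie_add D a b := by
    ext1 s
    change D.op (a s + b s) - (a (D.op s) + b (D.op s)) =
      (D.op (a s) - a (D.op s)) + (D.op (b s) - b (D.op s))
    rw [map_add]
    abel
  leibniz_lie D D' a := by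
    ext1 s
    change D.op (D'.op (a s) - a (D'.op s)) - (D'.op (a (D.op s)) - a (D'.op (D.op s))) =
      ((D.op (D'.op (a s)) - D'.op (D.op (a s))) - a (D.op (D'.op s) - D'.op (D.op s))) +
      (D'.op (D.op (a s) - a (D.op s)) - (D.op (a (D'.op s)) - a (D.op (D'.op s))))
    simp only [map_sub]
    abel

theorem inclusion_lie (D : DerAlgebroid m F E) (a : EndSections m F E) :
    inclusion m F E ⁅D, a⁆ = ⁅D, inclusion m F E a⁆ := by
  apply ext
  · exact (lie_zero (symbol m F E D)).symm
  · rfl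

instance : LieRinehartRep (SmoothFun m M) (DerAlgebroid m F E) (EndSections m F E) where
  smul_lie' f D a := by
    ext1 s
    change f • D.op (a s) - a (f • D.op s) = f • (D.op (a s) - a (D.op s))
    rw [map_smul, smul_sub]
  lie_smul' D f a := by
    ext1 s
    change D.op (f • a s) - f • a (D.op s) = f • (D.op (a s) - a (D.op s)) +
      symbol m F E D f • a s
    rw [op_smul, smul_sub]
    abel

end DerAlgebroid

end Bundles

/-! ### Fibres and traces of endomorphisms -/

noncomputable section Fibre

set_option linter.unusedSectionVars false

variable {m : ℕ} {M : Type*} [TopologicalSpace M] [ChartedSpace (EuclideanSpace ℝ (Fin m)) M]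
  [IsManifold (𝓡 m) ∞ M] [T2Space M]
  {F : Type*} [NormedAddCommGroup F] [NormedSpace ℂ F] {E : M → Type*}
  [TopologicalSpace (TotalSpace F E)] [∀ x, TopologicalSpace (E x)]
  [∀ x, AddCommGroup (E x)] [∀ x, Module ℂ (E x)] [FiberBundle F E] [VectorBundle ℂ F E]

theorem exists_cutoff (x : M) {U : Set M} (hU : U ∈ nhds x) :
    ∃ ψ : SmoothFun m M, (∀ᶠ y in nhds x, ψ y = 1) ∧ tsupport ψ ⊆ U := by
  obtain ⟨f, hf⟩ := (SmoothBumpFunction.nhds_basis_support (I := 𝓡 m) hU).ex_mem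
  refine ⟨⟨fun y => (f y : ℂ), ?_⟩, ?_, ?_⟩
  · exact (Complex.ofRealCLM.contDiff (n := ∞)).contMDiff.comp f.contMDiff
  · filter_upwards [f.eventuallyEq_one] with y hy
    change ((f y : ℝ) : ℂ) = 1
    rw [hy]
    simp
  · refine (closure_mono ?_).trans hf
    intro y hy hy'
    apply hy
    change ((f y : ℝ) : ℂ) = 0
    rw [hy']
    simp

variable [ContMDiffVectorBundle ∞ F E (𝓡 m)]

/-- The constant vector `v` in a local trivialization, cut off by `ψ`. -/
def cutoffSection (e : Trivialization F (TotalSpace.proj : TotalSpace F E → M))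
    [MemTrivializationAtlas e] (ψ : SmoothFun m M) (hψ : tsupport ψ ⊆ e.baseSet) (v : F) :
    Sections m F E where
  toFun y := ψ y • e.symm y v
  contMDiff_toFun := by
    intro y
    by_cases hy : y ∈ e.baseSet
    · rw [e.contMDiffAt_section_iff (IB := 𝓡 m) (n := ∞) hy]
      refine (contMDiffAt_complex_smul F ψ.contMDiff.contMDiffAt
        (contMDiffAt_const (c := v))).congr_of_eventuallyEq ?_
      filter_upwards [e.open_baseSet.mem_nhds hy] with z hz
      rw [(e.linear ℂ hz).map_smul]
      simp [e.apply_mk_symm hz]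
    · have hy' : y ∉ tsupport ψ := fun h => hy (hψ h)
      refine (Bundle.contMDiff_zeroSection ℝ E y).congr_of_eventuallyEq ?_
      filter_upwards [(isClosed_tsupport ψ).isOpen_compl.mem_nhds hy'] with z hz
      rw [image_eq_zero_of_notMem_tsupport hz, zero_smul]
      rfl

/-- A coefficient of a section in a local trivialization, cut off by `ψ`. -/
def cutoffCoeff (e : Trivialization F (TotalSpace.proj : TotalSpace F E → M))
    [MemTrivializationAtlas e] (ψ : SmoothFun m M) (hψ : tsupport ψ ⊆ e.baseSet) (l : F →L[ℂ] ℂ)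
    (s : Sections m F E) : SmoothFun m M where
  val y := ψ y * l (e ⟨y, s y⟩).2
  property := by
    refine contMDiff_of_tsupport fun y hy => ?_
    have hy : y ∈ e.baseSet := hψ (tsupport_mul_subset_left hy)
    have hs := (e.contMDiffAt_section_iff (IB := 𝓡 m) (n := ∞) hy).1 (s.contMDiff y)
    have hl : ContDiff ℝ ∞ l := (l.restrictScalars ℝ).contDiff
    exact contMDiffAt_complex_smul ℂ ψ.contMDiff.contMDiffAt
      (hl.contMDiff.contMDiffAt.comp y hs)

variable [FiniteDimensional ℂ F]

theorem sum_cutoff (e : Trivialization F (TotalSpace.proj : TotalSpace F E → M))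
    [MemTrivializationAtlas e] (ψ : SmoothFun m M) (hψ : tsupport ψ ⊆ e.baseSet)
    {ι : Type*} [Fintype ι] (b : Module.Basis ι ℂ F) (s : Sections m F E) :
    ∑ i, cutoffCoeff e ψ hψ (b.coord i).toContinuousLinearMap s • cutoffSection e ψ hψ (b i) =
      (ψ * ψ) • s := by
  ext x
  have h : ∀ t : ι → Sections m F E, (∑ i, t i) x = ∑ i, t i x := fun t =>
    map_sum ((Pi.evalAddMonoidHom _ x).comp (ContMDiffSection.coeAddHom (𝓡 m) F ∞ E)) t Finset.univ
  rw [h]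
  simp only [Sections.smul_apply]
  change ∑ i, (ψ x * b.coord i (e ⟨x, s x⟩).2) • ψ x • e.symm x (b i) = (ψ x * ψ x) • s x
  by_cases hx : x ∈ e.baseSet
  · have h2 : s x = ∑ i, b.coord i (e ⟨x, s x⟩).2 • e.symm x (b i) := by
      have h3 := (e.continuousLinearEquivAt ℂ x hx).symm_apply_apply (s x)
      have h4 : ∀ v, (e.continuousLinearEquivAt ℂ x hx).symm v = e.symm x v := fun v => rfl
      have h5 : e.continuousLinearEquivAt ℂ x hx (s x) = (e ⟨x, s x⟩).2 := rfl
      rw [h5] at h3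
      conv_lhs => rw [← h3, ← b.sum_repr (e ⟨x, s x⟩).2]
      rw [map_sum]
      refine Finset.sum_congr rfl fun i _ => ?_
      rw [map_smul, h4, Module.Basis.coord_apply]
    conv_rhs => rw [h2]
    rw [Finset.smul_sum]
    refine Finset.sum_congr rfl fun i _ => ?_
    rw [smul_smul, smul_smul]
    congr 1
    ring
  · have : ψ x = 0 := image_eq_zero_of_notMem_tsupport fun h => hx (hψ h)
    simp [this]

theorem exists_section (x : M) (v : E x) : ∃ s : Sections m F E, s x = v := by
  obtain ⟨ψ, h1, h2⟩ := exists_cutoff (m := m) x ((trivializationAt F E x).open_baseSet.mem_nhds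
    (FiberBundle.mem_baseSet_trivializationAt F E x))
  refine ⟨cutoffSection (trivializationAt F E x) ψ h2 (trivializationAt F E x ⟨x, v⟩).2, ?_⟩
  change ψ x • (trivializationAt F E x).symm x _ = _
  rw [h1.self_of_nhds, one_smul]
  exact (trivializationAt F E x).symm_apply_apply_mk
    (FiberBundle.mem_baseSet_trivializationAt F E x) v

theorem endSections_apply_eq_zero (a : EndSections m F E) {s : Sections m F E} {x : M}
    (hs : s x = 0) : a s x = 0 := by
  obtain ⟨ψ, h1, h2⟩ := exists_cutoff (m := m) x ((trivializationAt F E x).open_baseSet.mem_nhds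
    (FiberBundle.mem_baseSet_trivializationAt F E x))
  have h := sum_cutoff (trivializationAt F E x) ψ h2 (Module.finBasis ℂ F) s
  have h3 : ψ x * ψ x = 1 := by rw [h1.self_of_nhds, one_mul]
  have h4 : a s x = ((ψ * ψ) • a s) x := by
    rw [Sections.smul_apply]
    change a s x = (ψ x * ψ x) • a s x
    rw [h3, one_smul]
  have hsum : ∀ t : Fin (Module.finrank ℂ F) → Sections m F E, (∑ i, t i) x = ∑ i, t i x := fun t =>
    map_sum ((Pi.evalAddMonoidHom _ x).comp (ContMDiffSection.coeAddHom (𝓡 m) F ∞ E)) t Finset.univ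
  rw [h4, ← map_smul, ← h, map_sum, hsum]
  refine Finset.sum_eq_zero fun i _ => ?_
  rw [map_smul, Sections.smul_apply]
  have : cutoffCoeff (trivializationAt F E x) ψ h2 ((Module.finBasis ℂ F).coord i).toContinuousLinearMap s x
      = 0 := by
    change ψ x * (Module.finBasis ℂ F).coord i (trivializationAt F E x ⟨x, s x⟩).2 = 0
    rw [hs, ((trivializationAt F E x).linear ℂ
      (FiberBundle.mem_baseSet_trivializationAt F E x)).map_zero, map_zero, mul_zero]
  rw [this, zero_smul]

theorem endSections_congr (a : EndSections m F E) {s t : Sections m F E} {x : M}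
    (h : s x = t x) : a s x = a t x := by
  have := endSections_apply_eq_zero a (s := s - t) (x := x) (by
    rw [ContMDiffSection.coe_sub, Pi.sub_apply, h, sub_self])
  rw [map_sub, ContMDiffSection.coe_sub, Pi.sub_apply] at this
  exact sub_eq_zero.1 this

/-- The value `a(x) ∈ End(E_x)` at `x` of `a ∈ A(E)`: it maps `s(x)` to `(a s)(x)`. -/
def fibreEnd (a : EndSections m F E) (x : M) : Module.End ℂ (E x) where
  toFun v := a (exists_section (m := m) (F := F) x v).choose x
  map_add' v w := by
    set sv := (exists_section (m := m) (F := F) x v)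
    set sw := (exists_section (m := m) (F := F) x w)
    rw [endSections_congr a (t := sv.choose + sw.choose), map_add]
    · rfl
    · rw [(exists_section x (v + w)).choose_spec, ContMDiffSection.coe_add, Pi.add_apply,
        sv.choose_spec, sw.choose_spec]
  map_smul' c v := by
    set sv := (exists_section (m := m) (F := F) x v)
    let C : SmoothFun m M := ⟨fun _ => c, contMDiff_const⟩
    rw [endSections_congr a (t := C • sv.choose), map_smul]
    · rfl
    · rw [(exists_section x (c • v)).choose_spec, Sections.smul_apply, sv.choose_spec]
      rfl

theorem fibreEnd_apply (a : EndSections m F E) (s : Sections m F E) (x : M) :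
    fibreEnd a x (s x) = a s x :=
  endSections_congr a (exists_section (m := m) (F := F) x (s x)).choose_spec

theorem fibreEnd_add (a b : EndSections m F E) (x : M) :
    fibreEnd (a + b) x = fibreEnd a x + fibreEnd b x := rfl

theorem fibreEnd_smul (f : SmoothFun m M) (a : EndSections m F E) (x : M) :
    fibreEnd (f • a) x = f x • fibreEnd a x := rfl

theorem contMDiff_trace (a : EndSections m F E) :
    ContMDiff (𝓡 m) 𝓘(ℝ, ℂ) ∞ fun x => LinearMap.trace ℂ (E x) (fibreEnd a x) := by
  intro x₀
  set e := trivializationAt F E x₀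
  have he : e.baseSet ∈ nhds x₀ :=
    e.open_baseSet.mem_nhds (FiberBundle.mem_baseSet_trivializationAt F E x₀)
  obtain ⟨ψ, h1, h2⟩ := exists_cutoff (m := m) x₀ he
  set b := Module.finBasis ℂ F
  have h : ContMDiffAt (𝓡 m) 𝓘(ℝ, ℂ) ∞ (fun x => (∑ i, cutoffCoeff e ψ h2
      (b.coord i).toContinuousLinearMap (a (cutoffSection e ψ h2 (b i)))) x) x₀ :=
    (∑ i, cutoffCoeff e ψ h2 (b.coord i).toContinuousLinearMap
      (a (cutoffSection e ψ h2 (b i)))).contMDiff x₀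
  refine h.congr_of_eventuallyEq ?_
  filter_upwards [h1, he] with x hx hx'
  have hsum : ∀ t : Fin (Module.finrank ℂ F) → SmoothFun m M, (∑ i, t i) x = ∑ i, t i x := fun t =>
    map_sum (ContMDiffMap.evalRingHom (I := 𝓡 m) (n := ∞) (I' := 𝓘(ℝ, ℂ)) (R := ℂ) x) t Finset.univ
  rw [hsum, LinearMap.trace_eq_matrix_trace ℂ
    (b.map (e.continuousLinearEquivAt ℂ x hx').symm.toLinearEquiv), Matrix.trace]
  refine Finset.sum_congr rfl fun i _ => ?_
  rw [Matrix.diag_apply, LinearMap.toMatrix_apply]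
  have h3 : (b.map (e.continuousLinearEquivAt ℂ x hx').symm.toLinearEquiv) i =
      cutoffSection e ψ h2 (b i) x := by
    change e.symm x (b i) = ψ x • e.symm x (b i)
    rw [hx, one_smul]
  rw [h3, fibreEnd_apply]
  change _ = ψ x * _
  rw [hx, one_mul]
  rfl

variable (m F E) in
/-- The trace `tr : A(E) → C^∞(M)`. -/
def traceMap : EndSections m F E →ₗ[SmoothFun m M] SmoothFun m M where
  toFun a := ⟨fun x => LinearMap.trace ℂ (E x) (fibreEnd a x), contMDiff_trace a⟩
  map_add' a b := by
    ext x
    change LinearMap.trace ℂ (E x) (fibreEnd (a + b) x) = LinearMap.trace ℂ (E x) (fibreEnd a x) +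
      LinearMap.trace ℂ (E x) (fibreEnd b x)
    rw [fibreEnd_add, map_add]
  map_smul' f a := by
    ext x
    change LinearMap.trace ℂ (E x) (fibreEnd (f • a) x) =
      f x * LinearMap.trace ℂ (E x) (fibreEnd a x)
    rw [fibreEnd_smul, map_smul, smul_eq_mul]

end Fibre

/-! ### Forms and inner integration -/

noncomputable section Integration

/-- The differential of a graded form `ω = (ω_k)_k`: the part of degree `k + 1` of `dω` is
`d(ω_k)`. -/
def gradedDifferential {R L V : Type*} [CommRing R] [LieRing L] [Module R L] [LieRingModule L R]
    [AddCommGroup V] [Module R V] [LieRingModule L V] [Module ℝ V] [LieRinehartRing R L]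
    [LieRinehartRep R L V] (α : ∀ k : ℕ, L [⋀^Fin k]→ₗ[R] V) : ∀ k : ℕ, L [⋀^Fin k]→ₗ[R] V
  | 0 => 0
  | k + 1 => lieDifferential (α k)

variable {m : ℕ} {M : Type*} [TopologicalSpace M] [ChartedSpace (EuclideanSpace ℝ (Fin m)) M]

variable (m M) in
/-- `Ω^k(M)`: the `C^∞(M)`-multilinear alternating maps `Γ(TM)^k → C^∞(M)`. -/
abbrev BaseForm (k : ℕ) := VectorFields m M [⋀^Fin k]→ₗ[SmoothFun m M] SmoothFun m M

variable {F : Type*} [NormedAddCommGroup F] [NormedSpace ℂ F] {E : M → Type*}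
  [TopologicalSpace (TotalSpace F E)] [∀ x, TopologicalSpace (E x)]
  [∀ x, AddCommGroup (E x)] [∀ x, Module ℂ (E x)] [FiberBundle F E] [VectorBundle ℂ F E]

variable (m F E) in
/-- `Ω^k(M, End E)`. -/
abbrev BaseEndForm (k : ℕ) := VectorFields m M [⋀^Fin k]→ₗ[SmoothFun m M] EndSections m F E

variable (m F E) in
/-- `Ω^k_Lie(E, A(E))`: the forms of degree `k` on `𝔇(E)` with values in the kernel `A(E)`. -/
abbrev LieForm (k : ℕ) := DerAlgebroid m F E [⋀^Fin k]→ₗ[SmoothFun m M] EndSections m F E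

/-- The basis of `End(E_x)` that corresponds to the basis `b` of `End(F)` in the local
trivialization of `End(E)` induced by a local trivialization `e` of `E`. -/
def fibreBasis {n : ℕ} (b : Module.Basis (Fin n) ℂ (Module.End ℂ F))
    (e : Trivialization F (TotalSpace.proj : TotalSpace F E → M)) [MemTrivializationAtlas e]
    (x : M) (hx : x ∈ e.baseSet) : Module.Basis (Fin n) ℂ (Module.End ℂ (E x)) :=
  b.map (e.linearEquivAt ℂ x hx).symm.conj

/-- The inner metric `h(a, b) = tr(ab)` in the fibre over `x`. -/
def innerMetric (x : M) (A B : Module.End ℂ (E x)) : ℂ := LinearMap.trace ℂ (E x) (A * B)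

/-- The inner volume form `√|h| θ^1 ∧ ⋯ ∧ θ^n` over `x`, in a local trivialization: `θ` is the
dual basis of `fibreBasis` and `|h|` is the absolute value of the determinant of the matrix of the
inner metric in the basis. -/
def innerVolume {n : ℕ} (b : Module.Basis (Fin n) ℂ (Module.End ℂ F))
    (e : Trivialization F (TotalSpace.proj : TotalSpace F E → M)) [MemTrivializationAtlas e]
    (x : M) (hx : x ∈ e.baseSet) : Module.End ℂ (E x) [⋀^Fin n]→ₗ[ℂ] ℂ :=
  ((Real.sqrt ‖(Matrix.of fun i j =>
    innerMetric x (fibreBasis b e x hx i) (fibreBasis b e x hx j)).det‖ : ℝ) : ℂ) •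
      (fibreBasis b e x hx).det

variable [IsManifold (𝓡 m) ∞ M] [T2Space M] [ContMDiffVectorBundle ∞ F E (𝓡 m)]
  [FiniteDimensional ℂ F]

/-- `η` is the factor of `√|h| θ^1 ∧ ⋯ ∧ θ^n` in the form `α` of degree `q + n`: in every local
trivialization, `α = η ∧ √|h| θ^1 ∧ ⋯ ∧ θ^n +` terms of degree less than `n` in the `θ`s. The
latter terms are those that vanish when `n` arguments lie in the kernel `A(E)`, so this says
`α(D_1, …, D_q, a_1, …, a_n) = (√|h| θ^1 ∧ ⋯ ∧ θ^n)(a_1, …, a_n) η(σ D_1, …, σ D_q)`. -/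
def IsInnerIntegral {n : ℕ} (b : Module.Basis (Fin n) ℂ (Module.End ℂ F)) {q : ℕ}
    (α : LieForm m F E (q + n)) (η : BaseEndForm m F E q) : Prop :=
  ∀ (e : Trivialization F (TotalSpace.proj : TotalSpace F E → M)) [MemTrivializationAtlas e]
    (x : M) (hx : x ∈ e.baseSet) (D : Fin q → DerAlgebroid m F E) (a : Fin n → EndSections m F E),
    fibreEnd (α (Fin.append D fun j => DerAlgebroid.inclusion m F E (a j))) x =
      innerVolume b e x hx (fun j => fibreEnd (a j) x) •
        fibreEnd (η fun i => DerAlgebroid.symbol m F E (D i)) x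

/-- The inner integration `Ω^{q+n}_Lie(E, A(E)) → Ω^q(M, End E)`: the form `η` with
`IsInnerIntegral b α η`. -/
def innerIntegral {n : ℕ} (b : Module.Basis (Fin n) ℂ (Module.End ℂ F)) {q : ℕ}
    (α : LieForm m F E (q + n)) : BaseEndForm m F E q :=
  Classical.epsilon fun η => IsInnerIntegral b α η

/-- The traced inner integration `∫^tr_inner = tr ∘ ∫_inner : Ω^•_Lie(E, A(E)) → Ω^{•-n}(M)` on
graded forms. The parts of `α` of degree less than `n` do not contribute. -/
def traceInnerIntegral {n : ℕ} (b : Module.Basis (Fin n) ℂ (Module.End ℂ F))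
    (α : ∀ k, LieForm m F E k) : ∀ q, BaseForm m M q :=
  fun q => (traceMap m F E).compAlternatingMap (innerIntegral b (α (q + n)))

end Integration

/-! ### The trace form and the determinant on the endomorphisms of a vector space -/

noncomputable section TraceForm

set_option linter.unusedSectionVars false

open Module (End Basis)

variable {K V ι : Type*} [Field K] [AddCommGroup V] [Module K V] [FiniteDimensional K V]
  [Fintype ι] [DecidableEq ι]

/-! Everything is checked at a point x, in a trivialization with a cutoff ψ equal to 1 near x. There
the flat connection lifts a vector field X to an operator with symbol ψ²X that kills the constant
frame of E at x, and a basis of matrices gives a constant frame of A(E), of rank n.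

Existence and uniqueness of η. If n arguments of ω lie in A(E), one more argument in A(E) makes ω
vanish (`fibreEnd_map_inclusion_eq_zero`). So ω depends on the remaining D_i only through their
symbols (`fibreEnd_map_congr_symbol`), and on the a_j only through a determinant
(`fibreEnd_map_eq_det_smul`). Locally, η is therefore ω on flat lifts and the constant frame,
divided by √|h|. A change of trivialization conjugates the matrices. Left and right multiplication
by g are adjoint for the nondegenerate trace form, hence have the same determinant, so conjugation
has determinant one on matrices (`det_conj_eq_one`). The inner volume is thus global, and by
uniqueness the local factors glue.

Commutation with the differentials. For a flat lift D of X, Cartan's formula ι_D d = L_D - d ι_D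
gives an induction on q. Under the trace, [D, ·] becomes X, and the bracket of D with the constant
frame of A(E) vanishes at x, so L_D on ω becomes L_X on tr η (`traceMap_koszul_cons`). Once all flat
lifts are contracted, there remains the differential of a form of degree n - 1 on n arguments in
A(E) (`traceMap_koszul_cutoffEnd_eq_zero`). Its action terms are commutators, which the trace kills.
Its bracket terms form a Chevalley–Eilenberg differential into top degree, zero because the matrix
Lie algebra is unimodular: tr(ad g) is the trace of left minus that of right multiplication. -/

theorem End.eq_zero_of_trace_mul_eq_zero {A : End K V}
    (h : ∀ B, LinearMap.trace K V (A * B) = 0) : A = 0 := by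
  ext v
  refine (Module.forall_dual_apply_eq_zero_iff K _).1 fun φ => ?_
  -- Test against the rank one endomorphisms w ↦ φ(w) v: the trace of the product is φ(A v).
  have h1 : A * φ.smulRight v = φ.smulRight (A v) := by
    ext w
    simp
  have h2 := h (φ.smulRight v)
  rwa [h1, LinearMap.trace_smulRight] at h2

/-- The Gram matrix of the trace form in a basis of `End V`. -/
def traceGram (b : Basis ι K (End K V)) : Matrix ι ι K :=
  Matrix.of fun i j => LinearMap.trace K V (b i * b j)

/-- A vector killed by the Gram matrix is the coordinate vector of an endomorphism orthogonal to the
whole basis, which is zero by nondegeneracy. -/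
theorem det_traceGram_ne_zero (b : Basis ι K (End K V)) : (traceGram b).det ≠ 0 := by
  intro h
  obtain ⟨v, hv, hv'⟩ := Matrix.exists_vecMul_eq_zero_iff.2 h
  apply hv
  have h0 : ∑ i, v i • b i = 0 := by
    refine End.eq_zero_of_trace_mul_eq_zero fun B => ?_
    have h1 : ∀ j, LinearMap.trace K V ((∑ i, v i • b i) * b j) = 0 := by
      intro j
      have := congrFun hv' j
      simpa [Matrix.vecMul, dotProduct, traceGram, Finset.sum_mul] using this
    rw [← b.sum_repr B, Finset.mul_sum, map_sum]
    refine Finset.sum_eq_zero fun j _ => ?_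
    rw [mul_smul_comm, map_smul, h1, smul_zero]
  funext i
  have := congrArg (fun A => b.repr A i) h0
  simpa [map_sum, Finsupp.single_apply] using this

/-- By cyclicity tr(gA · B) = tr(A · Bg): left and right multiplication by g are adjoint for the
trace form. As the Gram matrix is invertible, they share determinant and trace. -/
theorem transpose_toMatrix_mulLeft_mul_traceGram (b : Basis ι K (End K V)) (g : End K V) :
    (LinearMap.toMatrix b b (LinearMap.mulLeft K g)).transpose * traceGram b =
      traceGram b * LinearMap.toMatrix b b (LinearMap.mulRight K g) := by
  ext i j
  have h1 : g * b i = ∑ k, b.repr (g * b i) k • b k := (b.sum_repr _).symm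
  have h2 : b j * g = ∑ k, b.repr (b j * g) k • b k := (b.sum_repr _).symm
  have h3 : LinearMap.trace K V (g * b i * b j) = LinearMap.trace K V (b i * (b j * g)) := by
    rw [mul_assoc, LinearMap.trace_mul_comm, mul_assoc]
  rw [h2] at h3
  nth_rewrite 1 [h1] at h3
  simp only [Finset.sum_mul, Finset.mul_sum, map_sum, smul_mul_assoc, mul_smul_comm, map_smul,
    smul_eq_mul] at h3
  simp only [Matrix.mul_apply, Matrix.transpose_apply, LinearMap.toMatrix_apply,
    LinearMap.mulLeft_apply, LinearMap.mulRight_apply, traceGram, Matrix.of_apply]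
  rw [h3]
  exact Finset.sum_congr rfl fun k _ => mul_comm _ _

theorem det_mulLeft_eq_det_mulRight (b : Basis ι K (End K V)) (g : End K V) :
    LinearMap.det (LinearMap.mulLeft K g) = LinearMap.det (LinearMap.mulRight K g) := by
  have h := congrArg Matrix.det (transpose_toMatrix_mulLeft_mul_traceGram b g)
  rw [Matrix.det_mul, Matrix.det_mul, Matrix.det_transpose, LinearMap.det_toMatrix,
    LinearMap.det_toMatrix, mul_comm] at h
  exact mul_left_cancel₀ (det_traceGram_ne_zero b) h

theorem trace_mulLeft_eq_trace_mulRight (b : Basis ι K (End K V)) (g : End K V) :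
    LinearMap.trace K _ (LinearMap.mulLeft K g) = LinearMap.trace K _ (LinearMap.mulRight K g) := by
  rw [LinearMap.trace_eq_matrix_trace K b, LinearMap.trace_eq_matrix_trace K b]
  have hG : IsUnit (traceGram b).det := (det_traceGram_ne_zero b).isUnit
  have h := congrArg (· * (traceGram b)⁻¹) (transpose_toMatrix_mulLeft_mul_traceGram b g)
  rw [Matrix.mul_nonsing_inv_cancel_right _ _ hG] at h
  rw [← Matrix.trace_transpose, h, Matrix.trace_mul_comm, Matrix.nonsing_inv_mul_cancel_left _ _ hG]

/-- Conjugation is left multiplication by g after right multiplication by g⁻¹. Trading the latter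
for left multiplication, of the same determinant, leaves the identity. -/
theorem det_conj_eq_one (b : Basis ι K (End K V)) (g : V ≃ₗ[K] V) :
    LinearMap.det (g.conj : End K V →ₗ[K] End K V) = 1 := by
  have h : (g.conj : End K V →ₗ[K] End K V) =
      LinearMap.mulLeft K (g : End K V) ∘ₗ LinearMap.mulRight K (g.symm : End K V) := by
    ext A v
    simp [LinearEquiv.conj_apply]
  rw [h, LinearMap.det_comp, ← det_mulLeft_eq_det_mulRight b, ← LinearMap.det_comp]
  rw [show LinearMap.mulLeft K (g : End K V) ∘ₗ LinearMap.mulLeft K (g.symm : End K V) =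
    LinearMap.id from LinearMap.ext fun A => LinearMap.ext fun v => by simp, LinearMap.det_id]

/-- In the Chevalley–Eilenberg complex with trivial coefficients of an associative algebra whose
commutator Lie algebra is unimodular, the differential into the top degree vanishes. -/
theorem sum_map_removeNth_update_lie_eq_zero {L W : Type*} [Ring L] [Algebra K L]
    [AddCommGroup W] [Module K W] {n : ℕ} (a : Basis (Fin (n + 1)) K L)
    (ha : ∀ x, LinearMap.trace K L (LinearMap.mulLeft K x) =
      LinearMap.trace K L (LinearMap.mulRight K x)) (β : L [⋀^Fin n]→ₗ[K] W) :
    ∑ i : Fin (n + 1), (-1 : ℤ) ^ (i : ℕ) •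
      ∑ j ∈ Finset.Ioi i, β (i.removeNth (Function.update a j (a i * a j - a j * a i))) = 0 := by
  set c : Fin (n + 1) → Fin (n + 1) → Fin (n + 1) → K := fun i j k => a.repr (a i * a j - a j * a i) k with hc
  have hskew : ∀ i j k, c i j k = - c j i k := by
    intro i j k
    simp only [hc]
    rw [← neg_sub, map_neg, Finsupp.neg_apply]
  set T : Fin (n + 1) → W := fun i => (-1 : ℤ) ^ (i : ℕ) • β (i.removeNth a) with hT
  -- Expand the bracket in the basis. Only its components along `a i` and `a j` survive, since any
  -- other basis vector already occurs among the arguments.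
  have key : ∀ i j : Fin (n + 1), i < j → (-1 : ℤ) ^ (i : ℕ) • β (i.removeNth (Function.update a j (a i * a j - a j * a i))) =
      c i j j • T i + c j i i • T j := by
    intro i j hij
    have hne : j ≠ i := hij.ne'
    obtain ⟨l, rfl⟩ := Fin.exists_succAbove_eq hne
    set j := i.succAbove l with hj
    have h1 : β (i.removeNth (Function.update a j (a i * a j - a j * a i))) =
        ∑ k, c i j k • β (i.removeNth (Function.update a j (a k))) := by
      rw [← a.sum_repr (a i * a j - a j * a i)]
      simp only [hj, Fin.removeNth_update_succAbove]
      rw [β.map_update_sum]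
      exact Finset.sum_congr rfl fun k _ => β.map_update_smul _ _ _ _
    have h2 : ∀ k, k ≠ i → k ≠ j → β (i.removeNth (Function.update a j (a k))) = 0 := by
      intro k hki hkj
      obtain ⟨k', rfl⟩ := Fin.exists_succAbove_eq hki
      have hkl : k' ≠ l := fun h => hkj (by rw [h])
      rw [hj, Fin.removeNth_update_succAbove]
      refine β.map_eq_zero_of_eq _ (i := k') (j := l) ?_ hkl
      rw [Function.update_of_ne hkl, Function.update_self]
      rfl
    have h3 : (-1 : ℤ) ^ (i : ℕ) • β (i.removeNth (Function.update a j (a i))) = - T j := by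
      have := β.neg_one_pow_smul_map_removeNth_add_eq_zero_of_eq
        (v := Function.update a j (a i)) (i := i) (j := j) (by simp [hne.symm]) hne.symm
      rw [Fin.removeNth_update] at this
      exact eq_neg_of_add_eq_zero_left (by exact_mod_cast this)
    rw [h1, Finset.smul_sum, ← Finset.sum_subset (Finset.subset_univ {j, i}), Finset.sum_pair hne,
      Function.update_eq_self, smul_comm, smul_comm _ (c i j i), h3, hskew i j i, neg_smul,
      smul_neg, neg_neg]
    intro k _ hk
    simp only [Finset.mem_insert, Finset.mem_singleton, not_or] at hk
    rw [h2 k hk.2 hk.1, smul_zero, smul_zero]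
  have h4 : ∑ i, ∑ j ∈ Finset.Ioi i, c j i i • T j = ∑ i, ∑ j ∈ Finset.Iio i, c i j j • T i :=
    Finset.sum_comm' (by simp)
  -- This sum is the trace of ad `a i`, that is the trace of left minus that of right
  -- multiplication.
  have h5 : ∀ i, ∑ j, c i j j = 0 := by
    intro i
    have := ha (a i)
    rw [LinearMap.trace_eq_matrix_trace K a, LinearMap.trace_eq_matrix_trace K a, Matrix.trace,
      Matrix.trace] at this
    simp only [Matrix.diag_apply, LinearMap.toMatrix_apply, LinearMap.mulLeft_apply,
      LinearMap.mulRight_apply] at this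
    simpa [hc, sub_eq_zero] using this
  calc _ = ∑ i, ∑ j ∈ Finset.Ioi i, (c i j j • T i + c j i i • T j) := by
        refine Finset.sum_congr rfl fun i _ => ?_
        rw [Finset.smul_sum]
        exact Finset.sum_congr rfl fun j hj => key i j (Finset.mem_Ioi.1 hj)
    _ = ∑ i, (∑ j ∈ Finset.Ioi i, c i j j • T i + ∑ j ∈ Finset.Iio i, c i j j • T i) := by
        simp only [Finset.sum_add_distrib]
        rw [h4]
    _ = ∑ i, ∑ j, c i j j • T i := by
        refine Finset.sum_congr rfl fun i _ => ?_
        rw [← Finset.sum_erase Finset.univ (a := i) (f := fun j => c i j j • T i) (by simp [hc]),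
          ← Finset.sum_union (Finset.disjoint_left.2 fun j hj hj' =>
            lt_asymm (Finset.mem_Ioi.1 hj) (Finset.mem_Iio.1 hj'))]
        refine Finset.sum_congr ?_ fun _ _ => rfl
        ext j
        simp [lt_or_lt_iff_ne, ne_comm]
    _ = 0 := by
        refine Finset.sum_eq_zero fun i _ => ?_
        rw [← Finset.sum_smul, h5, zero_smul]

end TraceForm

/-! ### Local data: cut off frames and flat lifts of vector fields -/

noncomputable section LocalData

set_option linter.unusedSectionVars false

variable {m : ℕ} {M : Type*} [TopologicalSpace M] [ChartedSpace (EuclideanSpace ℝ (Fin m)) M]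
  [IsManifold (𝓡 m) ∞ M] [T2Space M]
  {F : Type*} [NormedAddCommGroup F] [NormedSpace ℂ F] {E : M → Type*}
  [TopologicalSpace (TotalSpace F E)] [∀ x, TopologicalSpace (E x)]
  [∀ x, AddCommGroup (E x)] [∀ x, Module ℂ (E x)] [FiberBundle F E] [VectorBundle ℂ F E]

variable (m M) in
/-- The constant function with value `c`. -/
def constFun (c : ℂ) : SmoothFun m M := ⟨fun _ => c, contMDiff_const⟩

/-- Derivations are only assumed ℝ-linear, so complex constants need an argument. This is what makes
constant frames flat. -/
theorem VectorFields.apply_constFun (X : VectorFields m M) (c : ℂ) : X (constFun m M c) = 0 := by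
  have hI : X (constFun m M Complex.I) = 0 := by
    have h1 : constFun m M Complex.I * constFun m M Complex.I = algebraMap ℝ (SmoothFun m M) (-1) := by
      ext x
      change Complex.I * Complex.I = ((-1 : ℝ) : ℂ)
      simp
    have h2 := congrArg X h1
    rw [Derivation.leibniz, Derivation.map_algebraMap] at h2
    ext x
    have h3 := congrArg (fun f : SmoothFun m M => f x) h2
    change Complex.I * X (constFun m M Complex.I) x + Complex.I * X (constFun m M Complex.I) x = 0
      at h3
    rw [← two_mul, mul_eq_zero, mul_eq_zero] at h3
    simpa using h3
  have h : constFun m M c = c.re • (1 : SmoothFun m M) + c.im • constFun m M Complex.I := by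
    ext x
    change c = c.re • (1 : ℂ) + c.im • Complex.I
    simp
  rw [h, map_add, X.map_smul, X.map_smul, hI, Derivation.map_one_eq_zero, smul_zero, smul_zero, add_zero]

/-- Locality: with ψ supported where f vanishes, ψf = 0, and the Leibniz rule for X(ψf) at x leaves
only X(f)(x). -/
theorem VectorFields.apply_eq_zero_of_eventuallyEq_zero (X : VectorFields m M) {f : SmoothFun m M}
    {x : M} (h : ∀ᶠ y in nhds x, f y = 0) : X f x = 0 := by
  obtain ⟨ψ, h1, h2⟩ := exists_cutoff (m := m) x h
  have h3 : ψ * f = 0 := by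
    ext y
    change ψ y * f y = 0
    by_cases hy : y ∈ tsupport ψ
    · rw [h2 hy, mul_zero]
    · rw [image_eq_zero_of_notMem_tsupport hy, zero_mul]
  have h4 := congrArg (fun g : SmoothFun m M => g x) (congrArg X h3)
  rw [Derivation.leibniz, map_zero] at h4
  change ψ x * X f x + f x * X ψ x = 0 at h4
  rwa [h1.self_of_nhds, h.self_of_nhds, one_mul, zero_mul, add_zero] at h4

theorem VectorFields.apply_congr (X : VectorFields m M) {f g : SmoothFun m M} {x : M}
    (h : ∀ᶠ y in nhds x, f y = g y) : X f x = X g x := by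
  have h1 : X (f - g) x = 0 := X.apply_eq_zero_of_eventuallyEq_zero <| by
    filter_upwards [h] with y hy
    exact sub_eq_zero.2 hy
  rw [map_sub] at h1
  exact sub_eq_zero.1 h1

theorem SmoothFun.sum_apply {ι : Type*} (t : Finset ι) (f : ι → SmoothFun m M) (x : M) :
    (∑ i ∈ t, f i) x = ∑ i ∈ t, f i x :=
  map_sum (ContMDiffMap.evalRingHom (I := 𝓡 m) (n := ∞) (I' := 𝓘(ℝ, ℂ)) (R := ℂ) x) f t

theorem Sections.sum_apply {ι : Type*} (t : Finset ι) (s : ι → Sections m F E) (x : M) :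
    (∑ i ∈ t, s i) x = ∑ i ∈ t, s i x :=
  map_sum ((Pi.evalAddMonoidHom _ x).comp (ContMDiffSection.coeAddHom (𝓡 m) F ∞ E)) s t

variable [ContMDiffVectorBundle ∞ F E (𝓡 m)]

theorem cutoffSection_apply (e : Trivialization F (TotalSpace.proj : TotalSpace F E → M))
    [MemTrivializationAtlas e] (ψ : SmoothFun m M) (hψ : tsupport ψ ⊆ e.baseSet) (v : F) (x : M) :
    cutoffSection e ψ hψ v x = ψ x • e.symm x v := rfl

theorem cutoffCoeff_apply (e : Trivialization F (TotalSpace.proj : TotalSpace F E → M))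
    [MemTrivializationAtlas e] (ψ : SmoothFun m M) (hψ : tsupport ψ ⊆ e.baseSet) (l : F →L[ℂ] ℂ)
    (s : Sections m F E) (x : M) : cutoffCoeff e ψ hψ l s x = ψ x * l (e ⟨x, s x⟩).2 := rfl

theorem mem_baseSet_of_cutoff {e : Trivialization F (TotalSpace.proj : TotalSpace F E → M)}
    {ψ : SmoothFun m M} (hψ : tsupport ψ ⊆ e.baseSet) {x : M} (hx : ψ x = 1) : x ∈ e.baseSet := by
  refine hψ (subset_tsupport _ ?_)
  rw [Function.mem_support, hx]
  exact one_ne_zero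

variable (e : Trivialization F (TotalSpace.proj : TotalSpace F E → M)) [MemTrivializationAtlas e]
  (ψ : SmoothFun m M) (hψ : tsupport ψ ⊆ e.baseSet)

theorem cutoffCoeff_add (l : F →L[ℂ] ℂ) (s t : Sections m F E) :
    cutoffCoeff e ψ hψ l (s + t) = cutoffCoeff e ψ hψ l s + cutoffCoeff e ψ hψ l t := by
  ext x
  change ψ x * l (e ⟨x, s x + t x⟩).2 = ψ x * l (e ⟨x, s x⟩).2 + ψ x * l (e ⟨x, t x⟩).2
  by_cases hx : x ∈ e.baseSet
  · rw [(e.linear ℂ hx).map_add, map_add, mul_add]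
  -- Off the base set the trivialization need not be linear, but the cutoff vanishes there.
  · simp [image_eq_zero_of_notMem_tsupport fun h => hx (hψ h)]

theorem cutoffCoeff_smul (l : F →L[ℂ] ℂ) (f : SmoothFun m M) (s : Sections m F E) :
    cutoffCoeff e ψ hψ l (f • s) = f * cutoffCoeff e ψ hψ l s := by
  ext x
  change ψ x * l (e ⟨x, f x • s x⟩).2 = f x * (ψ x * l (e ⟨x, s x⟩).2)
  by_cases hx : x ∈ e.baseSet
  · rw [(e.linear ℂ hx).map_smul, map_smul, smul_eq_mul, mul_left_comm]
  · simp [image_eq_zero_of_notMem_tsupport fun h => hx (hψ h)]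

/-- The endomorphism `s ↦ l(s) v`, cut off by `ψ`, for constant `l` and `v` in a local
trivialization. -/
def cutoffRankOne (l : F →L[ℂ] ℂ) (v : F) : EndSections m F E where
  toFun s := cutoffCoeff e ψ hψ l s • cutoffSection e ψ hψ v
  map_add' s t := by rw [cutoffCoeff_add, add_smul]
  map_smul' f s := by rw [cutoffCoeff_smul, mul_smul, RingHom.id_apply]

theorem endSections_ext {a b : EndSections m F E} [FiniteDimensional ℂ F]
    (h : ∀ x, fibreEnd a x = fibreEnd b x) : a = b := by
  ext s x
  rw [← fibreEnd_apply a, ← fibreEnd_apply b, h]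

variable [FiniteDimensional ℂ F]

variable (m F E) in
/-- Evaluation of `A(E)` at `x`. -/
def fibreEndHom (x : M) : EndSections m F E →+ Module.End ℂ (E x) where
  toFun a := fibreEnd a x
  map_zero' := by
    refine LinearMap.ext fun v => ?_
    obtain ⟨s, rfl⟩ := exists_section (m := m) (F := F) x v
    rw [fibreEnd_apply]
    rfl
  map_add' a b := fibreEnd_add a b x

theorem fibreEnd_zero (x : M) : fibreEnd (0 : EndSections m F E) x = 0 :=
  (fibreEndHom m F E x).map_zero

theorem fibreEnd_sub (a b : EndSections m F E) (x : M) :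
    fibreEnd (a - b) x = fibreEnd a x - fibreEnd b x := (fibreEndHom m F E x).map_sub a b

theorem fibreEnd_sum {ι : Type*} (t : Finset ι) (a : ι → EndSections m F E) (x : M) :
    fibreEnd (∑ i ∈ t, a i) x = ∑ i ∈ t, fibreEnd (a i) x := map_sum (fibreEndHom m F E x) a t

theorem fibreEnd_mul (a b : EndSections m F E) (x : M) :
    fibreEnd (a * b) x = fibreEnd a x * fibreEnd b x := by
  ext v
  obtain ⟨s, rfl⟩ := exists_section (m := m) (F := F) x v
  change _ = fibreEnd a x (fibreEnd b x (s x))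
  rw [fibreEnd_apply, fibreEnd_apply, fibreEnd_apply]
  rfl

/-- A family of endomorphisms of the fibres which is locally given by elements of `A(E)` is
given by an element of `A(E)`. -/
theorem exists_endSections_of_local (T : ∀ x, Module.End ℂ (E x))
    (h : ∀ x, ∃ a : EndSections m F E, ∀ᶠ y in nhds x, fibreEnd a y = T y) :
    ∃ a : EndSections m F E, ∀ x, fibreEnd a x = T x := by
  let a : EndSections m F E :=
    { toFun := fun s => ⟨fun x => T x (s x), fun x => by
        obtain ⟨a, ha⟩ := h x
        refine ((a s).contMDiff x).congr_of_eventuallyEq ?_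
        filter_upwards [ha] with y hy
        rw [← hy, fibreEnd_apply]⟩
      map_add' := fun s t => by
        ext x
        exact map_add (T x) (s x) (t x)
      map_smul' := fun f s => by
        ext x
        exact map_smul (T x) (f x) (s x) }
  refine ⟨a, fun x => ?_⟩
  ext v
  obtain ⟨s, rfl⟩ := exists_section (m := m) (F := F) x v
  rw [fibreEnd_apply]
  rfl

/-- The constant endomorphism `B` in a local trivialization, cut off by `ψ²`. -/
def cutoffEnd (B : Module.End ℂ F) : EndSections m F E :=
  ∑ i, cutoffRankOne e ψ hψ ((Module.finBasis ℂ F).coord i).toContinuousLinearMap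
    (B (Module.finBasis ℂ F i))

/-- The factor ψ² arises because the coefficient and the section in each rank one term both carry a
ψ. -/
theorem fibreEnd_cutoffEnd (B : Module.End ℂ F) {x : M} (hx : x ∈ e.baseSet) :
    fibreEnd (cutoffEnd e ψ hψ B) x = (ψ x * ψ x) • (e.linearEquivAt ℂ x hx).symm.conj B := by
  ext v
  obtain ⟨s, rfl⟩ := exists_section (m := m) (F := F) x v
  rw [fibreEnd_apply, cutoffEnd, LinearMap.sum_apply, Sections.sum_apply]
  have h1 : ∀ i, (cutoffRankOne e ψ hψ ((Module.finBasis ℂ F).coord i).toContinuousLinearMap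
      (B (Module.finBasis ℂ F i)) s) x = (ψ x * ψ x) • (e.linearEquivAt ℂ x hx).symm
        (B ((Module.finBasis ℂ F).repr (e ⟨x, s x⟩).2 i • Module.finBasis ℂ F i)) := by
    intro i
    change (ψ x * (Module.finBasis ℂ F).repr (e ⟨x, s x⟩).2 i) •
      ψ x • (e.linearEquivAt ℂ x hx).symm (B (Module.finBasis ℂ F i)) = _
    rw [map_smul, map_smul, smul_smul, smul_smul]
    congr 1
    ring
  rw [Finset.sum_congr rfl fun i _ => h1 i, ← Finset.smul_sum, ← map_sum, ← map_sum,
    Module.Basis.sum_repr]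
  rfl

theorem fibreEnd_cutoffEnd_of_notMem (B : Module.End ℂ F) {x : M} (hx : x ∉ e.baseSet) :
    fibreEnd (cutoffEnd e ψ hψ B) x = 0 := by
  ext v
  obtain ⟨s, rfl⟩ := exists_section (m := m) (F := F) x v
  rw [fibreEnd_apply, cutoffEnd, LinearMap.sum_apply, Sections.sum_apply]
  refine Finset.sum_eq_zero fun i _ => ?_
  change (_ : ℂ) • ψ x • (_ : E x) = 0
  rw [image_eq_zero_of_notMem_tsupport fun h => hx (hψ h), zero_smul, smul_zero]

theorem fibreEnd_cutoffEnd_of_eq_one (B : Module.End ℂ F) {x : M} (hx : ψ x = 1) :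
    fibreEnd (cutoffEnd e ψ hψ B) x =
      (e.linearEquivAt ℂ x (mem_baseSet_of_cutoff hψ hx)).symm.conj B := by
  rw [fibreEnd_cutoffEnd e ψ hψ B (mem_baseSet_of_cutoff hψ hx), hx, one_mul, one_smul]

/-- `C^∞(M)`-linear maps `A(E) → A(E)` act pointwise. -/
theorem fibreEnd_map_eq_zero (φ : EndSections m F E →ₗ[SmoothFun m M] EndSections m F E)
    {a : EndSections m F E} {x : M} (ha : fibreEnd a x = 0) : fibreEnd (φ a) x = 0 := by
  obtain ⟨ψ, h1, hψ⟩ := exists_cutoff (m := m) x ((trivializationAt F E x).open_baseSet.mem_nhds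
    (FiberBundle.mem_baseSet_trivializationAt F E x))
  set e := trivializationAt F E x
  set b := Module.finBasis ℂ F
  have hx : ψ x = 1 := h1.self_of_nhds
  -- Expand a in matrix units with smooth coefficients. Decomposing both the argument and the value
  -- in the frame costs ψ² each. The coefficients vanish at x, and φ is linear over functions.
  have key : ((ψ * ψ) * (ψ * ψ)) • a = ∑ k, ∑ l,
      cutoffCoeff e ψ hψ (b.coord k).toContinuousLinearMap (a (cutoffSection e ψ hψ (b l))) •
        cutoffRankOne e ψ hψ (b.coord l).toContinuousLinearMap (b k) := by
    ext1 s
    rw [LinearMap.sum_apply]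
    simp only [LinearMap.sum_apply, LinearMap.smul_apply]
    rw [mul_smul, ← map_smul, ← sum_cutoff e ψ hψ b s, map_sum, Finset.smul_sum, Finset.sum_comm]
    refine Finset.sum_congr rfl fun l _ => ?_
    rw [map_smul, smul_comm, ← sum_cutoff e ψ hψ b, Finset.smul_sum]
    refine Finset.sum_congr rfl fun k _ => ?_
    rw [smul_comm]
    rfl
  have h2 := congrArg (fun c => fibreEnd (φ c) x) key
  simp only [map_smul, map_sum, fibreEnd_smul, fibreEnd_sum] at h2
  have h3 : ((ψ * ψ) * (ψ * ψ)) x = 1 := by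
    change (ψ x * ψ x) * (ψ x * ψ x) = 1
    rw [hx]
    norm_num
  rw [h3, one_smul] at h2
  rw [h2]
  refine Finset.sum_eq_zero fun k _ => Finset.sum_eq_zero fun l _ => ?_
  have h4 : cutoffCoeff e ψ hψ (b.coord k).toContinuousLinearMap
      (a (cutoffSection e ψ hψ (b l))) x = 0 := by
    rw [cutoffCoeff_apply, ← fibreEnd_apply, ha]
    change ψ x * b.coord k (e ⟨x, 0⟩).2 = 0
    rw [(e.linear ℂ (FiberBundle.mem_baseSet_trivializationAt F E x)).map_zero, map_zero, mul_zero]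
  rw [h4, zero_smul]

/-- The derivation of `E` along `X` of the flat connection of a local trivialization, cut off by
`ψ²`. -/
def flatDerivation (X : VectorFields m M) : DerAlgebroid m F E :=
  ⟨((ψ * ψ) • X,
    { toFun := fun s => ∑ i, X (cutoffCoeff e ψ hψ
        ((Module.finBasis ℂ F).coord i).toContinuousLinearMap s) •
          cutoffSection e ψ hψ (Module.finBasis ℂ F i)
      map_add' := fun s t => by
        simp only [cutoffCoeff_add, map_add, add_smul, Finset.sum_add_distrib]
      map_smul' := fun c s => by
        have h : ∀ l, cutoffCoeff e ψ hψ l (c • s) = c • cutoffCoeff e ψ hψ l s := by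
          intro l
          have h1 : c • s = (algebraMap ℝ (SmoothFun m M) c) • s := (algebraMap_smul _ c s).symm
          rw [h1, cutoffCoeff_smul, Algebra.smul_def]
        simp only [h, X.map_smul, smul_assoc, Finset.smul_sum, RingHom.id_apply] }), fun f s => by
    -- In the Leibniz rule the extra terms X(f) cᵢ sᵢ add up to X(f) ψ² s by `sum_cutoff`; hence the
    -- symbol ψ²X.
    change ∑ i : Fin (Module.finrank ℂ F), _ = f • ∑ i : Fin (Module.finrank ℂ F), _ + ((ψ * ψ) • X) f • s
    simp only [cutoffCoeff_smul, Derivation.leibniz, add_smul, Finset.sum_add_distrib,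
      Finset.smul_sum]
    rw [Derivation.smul_apply, smul_eq_mul, mul_comm _ (X f), mul_smul,
      ← sum_cutoff e ψ hψ (Module.finBasis ℂ F) s, Finset.smul_sum]
    congr 1
    · refine Finset.sum_congr rfl fun i _ => ?_
      rw [smul_eq_mul, mul_smul]
    · refine Finset.sum_congr rfl fun i _ => ?_
      rw [smul_eq_mul, mul_comm, mul_smul]⟩

theorem op_flatDerivation (X : VectorFields m M) (s : Sections m F E) :
    (flatDerivation e ψ hψ X).op s = ∑ i, X (cutoffCoeff e ψ hψ
      ((Module.finBasis ℂ F).coord i).toContinuousLinearMap s) •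
        cutoffSection e ψ hψ (Module.finBasis ℂ F i) := rfl

/-- The lift of vector fields to `𝔇(E)` by the flat connection of a local trivialization, cut off by
`ψ²`. -/
def flatLift : VectorFields m M →ₗ[SmoothFun m M] DerAlgebroid m F E where
  toFun := flatDerivation e ψ hψ
  map_add' X Y := by
    apply DerAlgebroid.ext
    · exact smul_add (ψ * ψ) X Y
    · ext1 s
      rw [DerAlgebroid.op_add, LinearMap.add_apply, op_flatDerivation, op_flatDerivation,
        op_flatDerivation, ← Finset.sum_add_distrib]
      exact Finset.sum_congr rfl fun i _ => add_smul _ _ _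
  map_smul' f X := by
    apply DerAlgebroid.ext
    · exact smul_comm (ψ * ψ) f X
    · ext1 s
      change (flatDerivation e ψ hψ (f • X)).op s = f • (flatDerivation e ψ hψ X).op s
      rw [op_flatDerivation, op_flatDerivation, Finset.smul_sum]
      exact Finset.sum_congr rfl fun i _ => mul_smul f _ _

theorem symbol_flatLift (X : VectorFields m M) :
    DerAlgebroid.symbol m F E (flatLift e ψ hψ X) = (ψ * ψ) • X := rfl

theorem op_flatLift (X : VectorFields m M) (s : Sections m F E) :
    (flatLift e ψ hψ X).op s = ∑ i, X (cutoffCoeff e ψ hψ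
      ((Module.finBasis ℂ F).coord i).toContinuousLinearMap s) •
        cutoffSection e ψ hψ (Module.finBasis ℂ F i) := rfl

variable {e ψ} {x : M}

theorem op_flatLift_congr (X : VectorFields m M) {s t : Sections m F E}
    (h : ∀ᶠ y in nhds x, s y = t y) :
    (flatLift e ψ hψ X).op s x = (flatLift e ψ hψ X).op t x := by
  rw [op_flatLift, op_flatLift, Sections.sum_apply, Sections.sum_apply]
  refine Finset.sum_congr rfl fun i _ => ?_
  rw [Sections.smul_apply, Sections.smul_apply]
  congr 1
  refine X.apply_congr ?_
  filter_upwards [h] with y hy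
  rw [cutoffCoeff_apply, cutoffCoeff_apply, hy]

theorem snd_cutoffSection (v : F) (hx : ψ x = 1) : (e ⟨x, cutoffSection e ψ hψ v x⟩).2 = v := by
  rw [cutoffSection_apply, hx, one_smul, e.apply_mk_symm (mem_baseSet_of_cutoff hψ hx)]

/-- Near x the cut off section has constant coefficients, which X annihilates. This needs ψ = 1 on a
neighbourhood, not only at x. -/
theorem op_flatLift_cutoffSection (h1 : ∀ᶠ y in nhds x, ψ y = 1) (X : VectorFields m M) (v : F) :
    (flatLift e ψ hψ X).op (cutoffSection e ψ hψ v) x = 0 := by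
  rw [op_flatLift, Sections.sum_apply]
  refine Finset.sum_eq_zero fun i _ => ?_
  have h : X (cutoffCoeff e ψ hψ ((Module.finBasis ℂ F).coord i).toContinuousLinearMap
      (cutoffSection e ψ hψ v)) x = 0 := by
    rw [X.apply_congr (g := constFun m M ((Module.finBasis ℂ F).coord i v)), X.apply_constFun]
    · rfl
    · filter_upwards [h1] with y hy
      rw [cutoffCoeff_apply, snd_cutoffSection hψ v hy, hy, one_mul]
      rfl
  rw [Sections.smul_apply, h, zero_smul]

theorem exists_cutoffSection_eq (hx : ψ x = 1) (v : E x) :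
    ∃ w, cutoffSection e ψ hψ w x = v := by
  refine ⟨(e ⟨x, v⟩).2, ?_⟩
  rw [cutoffSection_apply, hx, one_smul, e.symm_apply_apply_mk (mem_baseSet_of_cutoff hψ hx)]

/-- Constant sections span the fibre, are killed by the flat lift at x, and are mapped near x to
constant sections by a constant endomorphism. So both terms of the commutator vanish on them. -/
theorem fibreEnd_lie_flatLift_cutoffEnd (h1 : ∀ᶠ y in nhds x, ψ y = 1) (X : VectorFields m M)
    (B : Module.End ℂ F) : fibreEnd ⁅flatLift e ψ hψ X, cutoffEnd e ψ hψ B⁆ x = 0 := by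
  have hx := h1.self_of_nhds
  refine LinearMap.ext fun v => ?_
  obtain ⟨w, rfl⟩ := exists_cutoffSection_eq hψ hx v
  rw [fibreEnd_apply]
  change ((flatLift e ψ hψ X).op (cutoffEnd e ψ hψ B (cutoffSection e ψ hψ w))) x -
    cutoffEnd e ψ hψ B ((flatLift e ψ hψ X).op (cutoffSection e ψ hψ w)) x = 0
  rw [endSections_apply_eq_zero _ (op_flatLift_cutoffSection hψ h1 X w), sub_zero,
    op_flatLift_congr hψ X (t := cutoffSection e ψ hψ (B w)), op_flatLift_cutoffSection hψ h1 X]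
  filter_upwards [h1] with y hy
  rw [← fibreEnd_apply, fibreEnd_cutoffEnd_of_eq_one e ψ hψ B hy, LinearEquiv.conj_apply_apply,
    LinearEquiv.symm_symm, e.linearEquivAt_apply, snd_cutoffSection hψ w hy, cutoffSection_apply,
    hy, one_smul]
  rfl

theorem traceMap_apply (a : EndSections m F E) (x : M) :
    traceMap m F E a x = LinearMap.trace ℂ (E x) (fibreEnd a x) := rfl

theorem traceMap_apply_eq_sum (hx : ψ x = 1) (a : EndSections m F E) :
    traceMap m F E a x = ∑ i, (Module.finBasis ℂ F).coord i
      (e ⟨x, a (cutoffSection e ψ hψ (Module.finBasis ℂ F i)) x⟩).2 := by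
  rw [traceMap_apply, LinearMap.trace_eq_matrix_trace ℂ ((Module.finBasis ℂ F).map
    (e.linearEquivAt ℂ x (mem_baseSet_of_cutoff hψ hx)).symm), Matrix.trace]
  refine Finset.sum_congr rfl fun i _ => ?_
  rw [Matrix.diag_apply, LinearMap.toMatrix_apply]
  have h3 : ((Module.finBasis ℂ F).map
      (e.linearEquivAt ℂ x (mem_baseSet_of_cutoff hψ hx)).symm) i =
      cutoffSection e ψ hψ (Module.finBasis ℂ F i) x := by
    rw [cutoffSection_apply, hx, one_smul]
    rfl
  rw [h3, fibreEnd_apply]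
  rfl

/-- The trace intertwines the adjoint representation with the action on functions. -/
theorem traceMap_lie_flatLift (h1 : ∀ᶠ y in nhds x, ψ y = 1) (X : VectorFields m M)
    (a : EndSections m F E) :
    traceMap m F E ⁅flatLift e ψ hψ X, a⁆ x = X (traceMap m F E a) x := by
  have hx := h1.self_of_nhds
  set b := Module.finBasis ℂ F with hb
  rw [traceMap_apply_eq_sum hψ hx, X.apply_congr (g := ∑ i, cutoffCoeff e ψ hψ
    (b.coord i).toContinuousLinearMap (a (cutoffSection e ψ hψ (b i)))), map_sum,
    SmoothFun.sum_apply]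
  · refine Finset.sum_congr rfl fun i _ => ?_
    -- The other half of the commutator vanishes because the frame is flat at x, so the diagonal
    -- entries of a are simply differentiated.
    have h2 : (⁅flatLift e ψ hψ X, a⁆ : EndSections m F E) (cutoffSection e ψ hψ (b i)) x =
        (flatLift e ψ hψ X).op (a (cutoffSection e ψ hψ (b i))) x := by
      change ((flatLift e ψ hψ X).op (a (cutoffSection e ψ hψ (b i)))) x -
        a ((flatLift e ψ hψ X).op (cutoffSection e ψ hψ (b i))) x = _
      rw [endSections_apply_eq_zero _ (op_flatLift_cutoffSection hψ h1 X (b i)), sub_zero]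
    rw [h2, op_flatLift, Sections.sum_apply]
    have hxe := mem_baseSet_of_cutoff hψ hx
    have h3 : ∀ v : E x, (e ⟨x, v⟩).2 = e.linearEquivAt ℂ x hxe v := fun v => rfl
    rw [h3, map_sum, map_sum, Finset.sum_eq_single i]
    · rw [Sections.smul_apply, map_smul, map_smul, ← h3, snd_cutoffSection hψ _ hx]
      simp [hb]
    · intro j _ hj
      rw [Sections.smul_apply, map_smul, map_smul, ← h3, snd_cutoffSection hψ _ hx]
      simp [hj.symm]
    · simp
  · filter_upwards [h1] with y hy
    rw [traceMap_apply_eq_sum hψ hy, SmoothFun.sum_apply]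
    refine Finset.sum_congr rfl fun i _ => ?_
    rw [cutoffCoeff_apply, hy, one_mul]
    rfl

end LocalData

/-! ### The inner integral -/

noncomputable section InnerIntegral

set_option linter.unusedSectionVars false

variable {m : ℕ} {M : Type*} [TopologicalSpace M] [ChartedSpace (EuclideanSpace ℝ (Fin m)) M]
  [IsManifold (𝓡 m) ∞ M] [T2Space M]
  {F : Type*} [NormedAddCommGroup F] [NormedSpace ℂ F] [FiniteDimensional ℂ F] {E : M → Type*}
  [TopologicalSpace (TotalSpace F E)] [∀ x, TopologicalSpace (E x)]
  [∀ x, AddCommGroup (E x)] [∀ x, Module ℂ (E x)] [FiberBundle F E] [VectorBundle ℂ F E]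
  [ContMDiffVectorBundle ∞ F E (𝓡 m)]

theorem SmoothFun.prod_apply {ι : Type*} (t : Finset ι) (f : ι → SmoothFun m M) (x : M) :
    (∏ i ∈ t, f i) x = ∏ i ∈ t, f i x :=
  map_prod (ContMDiffMap.evalRingHom (I := 𝓡 m) (n := ∞) (I' := 𝓘(ℝ, ℂ)) (R := ℂ) x) f t

/-- The arguments `D_1, …, D_q, a_1, …, a_n`. -/
def appendArgs {q n k : ℕ} (h : k = q + n) (D : Fin q → DerAlgebroid m F E)
    (a : Fin n → EndSections m F E) : Fin k → DerAlgebroid m F E :=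
  Fin.append D (fun j => DerAlgebroid.inclusion m F E (a j)) ∘ Fin.cast h

theorem appendArgs_update_left {q n k : ℕ} (h : k = q + n) (D : Fin q → DerAlgebroid m F E)
    (a : Fin n → EndSections m F E) (i : Fin q) (d : DerAlgebroid m F E) :
    appendArgs h (Function.update D i d) a =
      Function.update (appendArgs h D a) (Fin.cast h.symm (Fin.castAdd n i)) d := by
  subst h
  funext l
  refine Fin.addCases (fun l => ?_) (fun l => ?_) l
  · simp [appendArgs, Function.update_apply]
  · have : Fin.natAdd q l ≠ Fin.castAdd n i := by
      intro h
      have := congrArg Fin.val h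
      simp only [Fin.val_natAdd, Fin.val_castAdd] at this
      omega
    simp [appendArgs, this]

theorem appendArgs_update_right {q n k : ℕ} (h : k = q + n) (D : Fin q → DerAlgebroid m F E)
    (a : Fin n → EndSections m F E) (j : Fin n) (c : EndSections m F E) :
    appendArgs h D (Function.update a j c) = Function.update (appendArgs h D a)
      (Fin.cast h.symm (Fin.natAdd q j)) (DerAlgebroid.inclusion m F E c) := by
  subst h
  funext l
  refine Fin.addCases (fun l => ?_) (fun l => ?_) l
  · have : Fin.castAdd n l ≠ Fin.natAdd q j := by
      intro h
      have := congrArg Fin.val h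
      simp only [Fin.val_natAdd, Fin.val_castAdd] at this
      omega
    simp [appendArgs, this]
  · simp only [appendArgs, Function.comp_apply, Fin.cast_eq_self, Fin.append_right,
      Function.update_apply, Fin.natAdd_inj]
    split_ifs <;> rfl

theorem appendArgs_left {q n k : ℕ} (h : k = q + n) (D : Fin q → DerAlgebroid m F E)
    (a : Fin n → EndSections m F E) (i : Fin q) :
    appendArgs h D a (Fin.cast h.symm (Fin.castAdd n i)) = D i := by
  simp [appendArgs]

theorem appendArgs_right {q n k : ℕ} (h : k = q + n) (D : Fin q → DerAlgebroid m F E)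
    (a : Fin n → EndSections m F E) (j : Fin n) :
    appendArgs h D a (Fin.cast h.symm (Fin.natAdd q j)) = DerAlgebroid.inclusion m F E (a j) := by
  simp [appendArgs]

/-- A form on `𝔇(E)` with its first arguments fixed and the others restricted to `A(E)`. -/
def restrictLast {q n k : ℕ} (h : k = q + n) (α : LieForm m F E k)
    (D : Fin q → DerAlgebroid m F E) :
    EndSections m F E [⋀^Fin n]→ₗ[SmoothFun m M] EndSections m F E where
  toFun a := α (appendArgs h D a)
  map_update_add' := by
    intro d a j c c'
    obtain rfl : d = instDecidableEqFin n := Subsingleton.elim _ _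
    rw [appendArgs_update_right, appendArgs_update_right, appendArgs_update_right, map_add,
      α.map_update_add]
  map_update_smul' := by
    intro d a j f c
    obtain rfl : d = instDecidableEqFin n := Subsingleton.elim _ _
    rw [appendArgs_update_right, appendArgs_update_right, map_smul, α.map_update_smul]
  map_eq_zero_of_eq' := by
    intro a i j hij hne
    refine α.map_eq_zero_of_eq _ (i := Fin.cast h.symm (Fin.natAdd q i))
      (j := Fin.cast h.symm (Fin.natAdd q j)) ?_ ?_
    · rw [appendArgs_right, appendArgs_right, hij]
    · simpa using hne

/-- A form on `𝔇(E)` with its last arguments fixed in `A(E)`. -/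
def restrictFirst {q n k : ℕ} (h : k = q + n) (α : LieForm m F E k)
    (a : Fin n → EndSections m F E) :
    DerAlgebroid m F E [⋀^Fin q]→ₗ[SmoothFun m M] EndSections m F E where
  toFun D := α (appendArgs h D a)
  map_update_add' := by
    intro d D j c c'
    obtain rfl : d = instDecidableEqFin q := Subsingleton.elim _ _
    rw [appendArgs_update_left, appendArgs_update_left, appendArgs_update_left, α.map_update_add]
  map_update_smul' := by
    intro d D j f c
    obtain rfl : d = instDecidableEqFin q := Subsingleton.elim _ _
    rw [appendArgs_update_left, appendArgs_update_left, α.map_update_smul]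
  map_eq_zero_of_eq' := by
    intro D i j hij hne
    refine α.map_eq_zero_of_eq _ (i := Fin.cast h.symm (Fin.castAdd n i))
      (j := Fin.cast h.symm (Fin.castAdd n j)) ?_ ?_
    · rw [appendArgs_left, appendArgs_left, hij]
    · simpa using hne

/-- In a slot restricted to A(E), a form is a `C^∞(M)`-linear map from A(E) to itself, hence acts
pointwise. -/
theorem fibreEnd_map_update_inclusion_eq_zero {k : ℕ} (α : LieForm m F E k)
    (v : Fin k → DerAlgebroid m F E) (i : Fin k) {a : EndSections m F E} {x : M}
    (ha : fibreEnd a x = 0) :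
    fibreEnd (α (Function.update v i (DerAlgebroid.inclusion m F E a))) x = 0 :=
  fibreEnd_map_eq_zero ((α.toMultilinearMap.toLinearMap v i) ∘ₗ DerAlgebroid.inclusion m F E) ha

/-- Alternating forms on `A(E)` act pointwise. -/
theorem fibreEnd_map_congr {n : ℕ}
    (Φ : EndSections m F E [⋀^Fin n]→ₗ[SmoothFun m M] EndSections m F E)
    {a c : Fin n → EndSections m F E} {x : M} (h : ∀ j, fibreEnd (a j) x = fibreEnd (c j) x) :
    fibreEnd (Φ a) x = fibreEnd (Φ c) x := by
  -- The arguments are exchanged one at a time; each difference has an argument vanishing at x.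
  have key : ∀ t : Finset (Fin n), fibreEnd (Φ (t.piecewise a c)) x = fibreEnd (Φ c) x := by
    intro t
    induction t using Finset.induction_on with
    | empty => rw [Finset.piecewise_empty]
    | insert j t hj ih =>
      rw [← ih, ← sub_eq_zero, ← fibreEnd_sub, Finset.piecewise_insert]
      nth_rewrite 2 [← Function.update_eq_self j (t.piecewise a c)]
      rw [← Φ.map_update_sub]
      refine fibreEnd_map_eq_zero (Φ.toMultilinearMap.toLinearMap (t.piecewise a c) j) ?_
      rw [fibreEnd_sub, t.piecewise_eq_of_notMem _ _ hj, h, sub_self]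
  simpa using key Finset.univ

variable {e : Trivialization F (TotalSpace.proj : TotalSpace F E → M)} [MemTrivializationAtlas e]
  {ψ : SmoothFun m M} (hψ : tsupport ψ ⊆ e.baseSet) {x : M}

theorem cutoffEnd_add (A B : Module.End ℂ F) :
    cutoffEnd e ψ hψ (A + B) = cutoffEnd e ψ hψ A + cutoffEnd e ψ hψ B := by
  refine endSections_ext fun y => ?_
  rw [fibreEnd_add]
  by_cases hy : y ∈ e.baseSet
  · rw [fibreEnd_cutoffEnd e ψ hψ _ hy, fibreEnd_cutoffEnd e ψ hψ _ hy,
      fibreEnd_cutoffEnd e ψ hψ _ hy, map_add, smul_add]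
  · have h0 : ∀ B, fibreEnd (cutoffEnd e ψ hψ B) y = 0 := fun B =>
      fibreEnd_cutoffEnd_of_notMem e ψ hψ B hy
    rw [h0, h0, h0, add_zero]

theorem cutoffEnd_smul (c : ℂ) (A : Module.End ℂ F) :
    cutoffEnd e ψ hψ (c • A) = constFun m M c • cutoffEnd e ψ hψ A := by
  refine endSections_ext fun y => ?_
  rw [fibreEnd_smul]
  by_cases hy : y ∈ e.baseSet
  · rw [fibreEnd_cutoffEnd e ψ hψ _ hy, fibreEnd_cutoffEnd e ψ hψ _ hy, map_smul, smul_comm]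
    rfl
  · have h0 : ∀ B, fibreEnd (cutoffEnd e ψ hψ B) y = 0 := fun B =>
      fibreEnd_cutoffEnd_of_notMem e ψ hψ B hy
    rw [h0, h0, smul_zero]

/-- The value at `x` of an alternating form on `A(E)`, in a local trivialization. -/
def pointForm (x : M) {n : ℕ}
    (Φ : EndSections m F E [⋀^Fin n]→ₗ[SmoothFun m M] EndSections m F E) :
    Module.End ℂ F [⋀^Fin n]→ₗ[ℂ] Module.End ℂ (E x) where
  toFun B := fibreEnd (Φ (cutoffEnd e ψ hψ ∘ B)) x
  map_update_add' := by
    intro d B j c c'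
    obtain rfl : d = instDecidableEqFin n := Subsingleton.elim _ _
    rw [Function.comp_update, Function.comp_update, Function.comp_update, cutoffEnd_add,
      Φ.map_update_add, fibreEnd_add]
  map_update_smul' := by
    intro d B j f c
    obtain rfl : d = instDecidableEqFin n := Subsingleton.elim _ _
    rw [Function.comp_update, Function.comp_update, cutoffEnd_smul, Φ.map_update_smul,
      fibreEnd_smul]
    rfl
  map_eq_zero_of_eq' := by
    intro B i j hij hne
    rw [Φ.map_eq_zero_of_eq _ (i := i) (j := j) (by simp [hij]) hne, fibreEnd_zero]

theorem pointForm_apply {n : ℕ}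
    (Φ : EndSections m F E [⋀^Fin n]→ₗ[SmoothFun m M] EndSections m F E)
    (B : Fin n → Module.End ℂ F) :
    pointForm hψ x Φ B = fibreEnd (Φ (cutoffEnd e ψ hψ ∘ B)) x := rfl

/-- Linear functionals on W reduce this to the scalar-valued case. -/
theorem AlternatingMap.eq_basis_det_smul {K V W : Type*} [Field K] [AddCommGroup V] [Module K V]
    [AddCommGroup W] [Module K W] {n : ℕ} (b : Module.Basis (Fin n) K V) (Φ : V [⋀^Fin n]→ₗ[K] W)
    (v : Fin n → V) : Φ v = b.det v • Φ b := by
  rw [← sub_eq_zero, ← Module.forall_dual_apply_eq_zero_iff K]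
  intro φ
  have h := congrArg (fun f => f v) ((φ.compAlternatingMap Φ).eq_smul_basis_det b)
  change φ (Φ v) = φ (Φ b) * b.det v at h
  rw [map_sub, map_smul, smul_eq_mul, h, mul_comm, sub_self]

variable {n : ℕ}

/-- A form of top degree on `A(E)` is determined by its value on a frame. -/
theorem fibreEnd_map_eq_det_smul (b : Module.Basis (Fin n) ℂ (Module.End ℂ F))
    (hx : ψ x = 1)
    (Φ : EndSections m F E [⋀^Fin n]→ₗ[SmoothFun m M] EndSections m F E)
    (a : Fin n → EndSections m F E) :
    fibreEnd (Φ a) x =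
      (fibreBasis b e x (mem_baseSet_of_cutoff hψ hx)).det (fun j => fibreEnd (a j) x) •
        fibreEnd (Φ fun j => cutoffEnd e ψ hψ (b j)) x := by
  have h := (pointForm hψ x Φ).eq_basis_det_smul b
    fun j => (e.linearEquivAt ℂ x (mem_baseSet_of_cutoff hψ hx)).symm.conj.symm (fibreEnd (a j) x)
  rw [fibreBasis, Module.Basis.det_map]
  refine Eq.trans ?_ h
  refine fibreEnd_map_congr Φ fun j => ?_
  rw [Function.comp_apply, fibreEnd_cutoffEnd_of_eq_one e ψ hψ _ hx, LinearEquiv.apply_symm_apply]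

/-- Here n + 1 arguments lie in A(E), whose rank is n. After reducing the last n to a frame, the
extra one expands in that frame at x, and every term repeats an argument. -/
theorem fibreEnd_map_inclusion_eq_zero (b : Module.Basis (Fin n) ℂ (Module.End ℂ F))
    (x : M) {q k : ℕ} (h : k = q + n)
    (α : LieForm m F E k) (D : Fin q → DerAlgebroid m F E) (i : Fin q) (c : EndSections m F E)
    (a : Fin n → EndSections m F E) :
    fibreEnd (α (appendArgs h (Function.update D i (DerAlgebroid.inclusion m F E c)) a)) x = 0 := by
  obtain ⟨ψ, h1, hψ⟩ := exists_cutoff (m := m) x ((trivializationAt F E x).open_baseSet.mem_nhds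
    (FiberBundle.mem_baseSet_trivializationAt F E x))
  set e := trivializationAt F E x
  have hx : ψ x = 1 := h1.self_of_nhds
  have h1 := fibreEnd_map_eq_det_smul hψ b hx
    (restrictLast h α (Function.update D i (DerAlgebroid.inclusion m F E c))) a
  refine h1.trans ?_
  suffices h2 : fibreEnd (α (appendArgs h (Function.update D i (DerAlgebroid.inclusion m F E c))
      fun j => cutoffEnd e ψ hψ (b j))) x = 0 by
    change _ • fibreEnd (α _) x = 0
    rw [h2, smul_zero]
  set A := (e.linearEquivAt ℂ x (mem_baseSet_of_cutoff hψ hx)).symm.conj.symm (fibreEnd c x)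
  -- A combination of the frame with constant coefficients that agrees with c at x.
  set c' : EndSections m F E := ∑ j, constFun m M (b.repr A j) • cutoffEnd e ψ hψ (b j)
  have hc : fibreEnd (c - c') x = 0 := by
    rw [fibreEnd_sub, fibreEnd_sum, sub_eq_zero]
    simp only [fibreEnd_smul, fibreEnd_cutoffEnd_of_eq_one e ψ hψ _ hx]
    change _ = ∑ j, b.repr A j • _
    simp only [← map_smul]
    rw [← map_sum, b.sum_repr, LinearEquiv.apply_symm_apply]
  rw [← sub_add_cancel c c', map_add, appendArgs_update_left, α.map_update_add, fibreEnd_add,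
    fibreEnd_map_update_inclusion_eq_zero α _ _ hc, zero_add, map_sum, α.map_update_sum,
    fibreEnd_sum]
  refine Finset.sum_eq_zero fun j _ => ?_
  rw [map_smul, α.map_update_smul, α.map_eq_zero_of_eq _ (i := Fin.cast h.symm (Fin.castAdd n i))
    (j := Fin.cast h.symm (Fin.natAdd q j)), smul_zero, fibreEnd_zero]
  · rw [Function.update_self, Function.update_of_ne, appendArgs_right]
    intro h
    have := congrArg Fin.val h
    simp only [Fin.val_cast, Fin.val_natAdd, Fin.val_castAdd] at this
    omega
  · intro h
    have := congrArg Fin.val h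
    simp only [Fin.val_cast, Fin.val_natAdd, Fin.val_castAdd] at this
    omega

/-- Exactness at 𝔇(E): with zero symbol, the Leibniz rule becomes linearity over functions. -/
theorem DerAlgebroid.exists_inclusion_eq {D : DerAlgebroid m F E}
    (h : DerAlgebroid.symbol m F E D = 0) : ∃ a, DerAlgebroid.inclusion m F E a = D := by
  refine ⟨{ toFun := D.op, map_add' := map_add D.op, map_smul' := fun f s => ?_ },
    DerAlgebroid.ext h.symm rfl⟩
  rw [DerAlgebroid.op_smul, h, Derivation.zero_apply, zero_smul, add_zero, RingHom.id_apply]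

/-- Two operators with the same symbol differ by an element of A(E), so exchanging one for the other
adds a term with n + 1 arguments in A(E), which vanishes. -/
theorem fibreEnd_map_congr_symbol (b : Module.Basis (Fin n) ℂ (Module.End ℂ F))
    (x : M) {q k : ℕ} (h : k = q + n)
    (α : LieForm m F E k) {D D' : Fin q → DerAlgebroid m F E}
    (hD : ∀ i, DerAlgebroid.symbol m F E (D i) = DerAlgebroid.symbol m F E (D' i))
    (a : Fin n → EndSections m F E) :
    fibreEnd (α (appendArgs h D a)) x = fibreEnd (α (appendArgs h D' a)) x := by
  have key : ∀ t : Finset (Fin q), fibreEnd (α (appendArgs h (t.piecewise D D') a)) x =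
      fibreEnd (α (appendArgs h D' a)) x := by
    intro t
    induction t using Finset.induction_on with
    | empty => rw [Finset.piecewise_empty]
    | insert j t hj ih =>
      obtain ⟨c, hc⟩ := DerAlgebroid.exists_inclusion_eq (D := D j - D' j)
        (by rw [map_sub, hD, sub_self])
      rw [← ih, ← sub_eq_zero, ← fibreEnd_sub, Finset.piecewise_insert]
      nth_rewrite 2 [← Function.update_eq_self j (t.piecewise D D')]
      rw [t.piecewise_eq_of_notMem _ _ hj, ← fibreEnd_map_inclusion_eq_zero b x h α
        (t.piecewise D D') j c a, hc]
      exact congrArg (fun s => fibreEnd s x)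
        ((restrictFirst h α a).map_update_sub (t.piecewise D D') j (D j) (D' j)).symm
  simpa using key Finset.univ

/-- The flat lift of σ(D) has the same symbol as ψ²D. The factors ψ² come out by multilinearity and
are 1 at x. -/
theorem fibreEnd_map_flatLift_symbol (b : Module.Basis (Fin n) ℂ (Module.End ℂ F))
    (hx : ψ x = 1) {q k : ℕ} (h : k = q + n)
    (α : LieForm m F E k) (D : Fin q → DerAlgebroid m F E) (a : Fin n → EndSections m F E) :
    fibreEnd (α (appendArgs h (fun i => flatLift e ψ hψ (DerAlgebroid.symbol m F E (D i))) a)) x =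
      fibreEnd (α (appendArgs h D a)) x := by
  rw [fibreEnd_map_congr_symbol b x h α (D' := fun i => (ψ * ψ) • D i)
    (fun i => by rw [symbol_flatLift, map_smul]) a]
  have h1 := (restrictFirst h α a).map_smul_univ (fun _ => ψ * ψ) D
  refine (congrArg (fun s => fibreEnd s x) h1).trans ?_
  have h2 : (∏ _i : Fin q, ψ * ψ) x = 1 := by
    rw [SmoothFun.prod_apply]
    refine Finset.prod_eq_one fun i _ => ?_
    change ψ x * ψ x = 1
    rw [hx, one_mul]
  change fibreEnd (_ • α (appendArgs h D a)) x = _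
  rw [fibreEnd_smul, h2, one_smul]

end InnerIntegral

/-! ### Invariance of the inner volume form; existence and uniqueness of the inner integral -/

noncomputable section InnerIntegralExistence

set_option linter.unusedSectionVars false

variable {m : ℕ} {M : Type*} [TopologicalSpace M] [ChartedSpace (EuclideanSpace ℝ (Fin m)) M]
  {F : Type*} [NormedAddCommGroup F] [NormedSpace ℂ F] [FiniteDimensional ℂ F] {E : M → Type*}
  [TopologicalSpace (TotalSpace F E)] [∀ x, TopologicalSpace (E x)]
  [∀ x, AddCommGroup (E x)] [∀ x, Module ℂ (E x)] [FiberBundle F E] [VectorBundle ℂ F E]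
  {n : ℕ}

/-- The factor `√|h|` of the inner volume form. -/
def volumeFactor (b : Module.Basis (Fin n) ℂ (Module.End ℂ F)) : ℂ :=
  ((Real.sqrt ‖(traceGram b).det‖ : ℝ) : ℂ)

theorem volumeFactor_ne_zero (b : Module.Basis (Fin n) ℂ (Module.End ℂ F)) :
    volumeFactor b ≠ 0 := by
  rw [volumeFactor, Complex.ofReal_ne_zero, Real.sqrt_ne_zero', norm_pos_iff]
  exact det_traceGram_ne_zero b

/-- The trace is invariant under conjugation, so the Gram matrix in the fibre is that of b: the
factor √|h| is the same at all points and in all trivializations. -/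
theorem innerVolume_apply (b : Module.Basis (Fin n) ℂ (Module.End ℂ F))
    (e : Trivialization F (TotalSpace.proj : TotalSpace F E → M)) [MemTrivializationAtlas e]
    (x : M) (hx : x ∈ e.baseSet) (A : Fin n → Module.End ℂ (E x)) :
    innerVolume b e x hx A = volumeFactor b * (fibreBasis b e x hx).det A := by
  have h : (Matrix.of fun i j => innerMetric x (fibreBasis b e x hx i) (fibreBasis b e x hx j)) =
      traceGram b := by
    ext i j
    rw [Matrix.of_apply, traceGram, Matrix.of_apply, innerMetric, fibreBasis,
      Module.Basis.map_apply, Module.Basis.map_apply]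
    rw [← LinearMap.trace_conj' (b i * b j) (e.linearEquivAt ℂ x hx).symm]
    congr 1
    exact (LinearEquiv.conj_comp _ _ _).symm
  rw [innerVolume, h]
  rfl

theorem LinearEquiv.conj_symm_conj_symm_apply {K V W : Type*} [Field K] [AddCommGroup V]
    [Module K V] [AddCommGroup W] [Module K W] (f f' : V ≃ₗ[K] W) (A : Module.End K V) :
    f.symm.conj.symm A = (f'.symm.trans f).conj (f'.symm.conj.symm A) := by
  rw [LinearEquiv.symm_apply_eq]
  obtain ⟨C, rfl⟩ := f'.symm.conj.surjective A
  rw [LinearEquiv.symm_apply_apply]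
  ext v
  simp [LinearEquiv.conj_apply]

/-- The inner volume form does not depend on the local trivialization. -/
theorem innerVolume_eq (b : Module.Basis (Fin n) ℂ (Module.End ℂ F))
    (e e' : Trivialization F (TotalSpace.proj : TotalSpace F E → M)) [MemTrivializationAtlas e]
    [MemTrivializationAtlas e'] (x : M) (hx : x ∈ e.baseSet) (hx' : x ∈ e'.baseSet) :
    innerVolume b e x hx = innerVolume b e' x hx' := by
  ext A
  rw [innerVolume_apply, innerVolume_apply]
  congr 1
  rw [fibreBasis, fibreBasis, Module.Basis.det_map, Module.Basis.det_map]
  set g : F ≃ₗ[ℂ] F := (e'.linearEquivAt ℂ x hx').symm.trans (e.linearEquivAt ℂ x hx)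
  -- The coordinates in the two trivializations differ by conjugation with the transition map g,
  -- which has determinant one on `End F`.
  have h := b.det_comp (g.conj : Module.End ℂ F →ₗ[ℂ] Module.End ℂ F)
    ((e'.linearEquivAt ℂ x hx').symm.conj.symm ∘ A)
  rw [det_conj_eq_one b, one_mul] at h
  rw [← h]
  congr 1
  funext j
  exact LinearEquiv.conj_symm_conj_symm_apply _ _ _

variable [IsManifold (𝓡 m) ∞ M] [T2Space M] [ContMDiffVectorBundle ∞ F E (𝓡 m)]

/-- The condition `IsInnerIntegral` at the point `x`. -/
def IsInnerIntegralAt (b : Module.Basis (Fin n) ℂ (Module.End ℂ F)) {q : ℕ}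
    (α : LieForm m F E (q + n)) (η : BaseEndForm m F E q) (x : M) : Prop :=
  ∀ (e : Trivialization F (TotalSpace.proj : TotalSpace F E → M)) [MemTrivializationAtlas e]
    (hx : x ∈ e.baseSet) (D : Fin q → DerAlgebroid m F E) (a : Fin n → EndSections m F E),
    fibreEnd (α (appendArgs rfl D a)) x =
      innerVolume b e x hx (fun j => fibreEnd (a j) x) •
        fibreEnd (η fun i => DerAlgebroid.symbol m F E (D i)) x

theorem isInnerIntegral_iff (b : Module.Basis (Fin n) ℂ (Module.End ℂ F)) {q : ℕ}
    (α : LieForm m F E (q + n)) (η : BaseEndForm m F E q) :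
    IsInnerIntegral b α η ↔ ∀ x, IsInnerIntegralAt b α η x :=
  ⟨fun h x e _ hx D a => h e x hx D a, fun h e _ x hx D a => h x e hx D a⟩

variable {e : Trivialization F (TotalSpace.proj : TotalSpace F E → M)} [MemTrivializationAtlas e]
  {ψ : SmoothFun m M} (hψ : tsupport ψ ⊆ e.baseSet) {x : M}

theorem innerVolume_cutoffEnd (b : Module.Basis (Fin n) ℂ (Module.End ℂ F)) (hx : ψ x = 1) :
    innerVolume b e x (mem_baseSet_of_cutoff hψ hx)
      (fun j => fibreEnd (cutoffEnd e ψ hψ (b j)) x) = volumeFactor b := by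
  have h : (fun j => fibreEnd (cutoffEnd e ψ hψ (b j)) x) =
      fibreBasis b e x (mem_baseSet_of_cutoff hψ hx) := by
    funext j
    rw [fibreEnd_cutoffEnd_of_eq_one e ψ hψ _ hx, fibreBasis, Module.Basis.map_apply]
  rw [innerVolume_apply, h, Module.Basis.det_self, mul_one]

/-- The inner integral in a local trivialization. -/
def localInnerIntegral (b : Module.Basis (Fin n) ℂ (Module.End ℂ F)) {q : ℕ}
    (α : LieForm m F E (q + n)) : BaseEndForm m F E q :=
  constFun m M (volumeFactor b)⁻¹ •
    (restrictFirst rfl α fun j => cutoffEnd e ψ hψ (b j)).compLinearMap (flatLift e ψ hψ)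

/-- For fixed D, the form in the a_j has top degree, so it is a determinant times its value on the
frame; there D may be replaced by flat lifts of its symbols. -/
theorem isInnerIntegralAt_localInnerIntegral (b : Module.Basis (Fin n) ℂ (Module.End ℂ F))
    {q : ℕ} (α : LieForm m F E (q + n)) (hx : ψ x = 1) :
    IsInnerIntegralAt b α (localInnerIntegral hψ b α) x := by
  intro e' _ hx' D a
  rw [innerVolume_eq b e' e x hx' (mem_baseSet_of_cutoff hψ hx), innerVolume_apply]
  refine (fibreEnd_map_eq_det_smul hψ b hx (restrictLast rfl α D) a).trans ?_
  have h : fibreEnd (localInnerIntegral hψ b α fun i => DerAlgebroid.symbol m F E (D i)) x =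
      (volumeFactor b)⁻¹ • fibreEnd (α (appendArgs rfl
        (fun i => flatLift e ψ hψ (DerAlgebroid.symbol m F E (D i)))
          fun j => cutoffEnd e ψ hψ (b j))) x := rfl
  rw [h, fibreEnd_map_flatLift_symbol hψ b hx, smul_smul, mul_right_comm,
    mul_inv_cancel₀ (volumeFactor_ne_zero b), one_mul]
  rfl

/-- Used with f = ψ², to replace the symbols ψ²X of cut off lifts by X at points where ψ = 1. -/
theorem map_smul_of_eq_one {L V : Type*} [AddCommGroup L] [Module (SmoothFun m M) L]
    [AddCommGroup V] [Module (SmoothFun m M) V] {q : ℕ} (η : L [⋀^Fin q]→ₗ[SmoothFun m M] V)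
    (f : SmoothFun m M) (hx : f x = 1) (X : Fin q → L) :
    ∃ g : SmoothFun m M, g x = 1 ∧ η (fun i => f • X i) = g • η X := by
  refine ⟨∏ _i : Fin q, f, ?_, η.map_smul_univ (fun _ => f) X⟩
  rw [SmoothFun.prod_apply]
  exact Finset.prod_eq_one fun i _ => hx

/-- Flat lifts and the constant frame recover η at x, since the inner volume of that frame is the
nonzero constant √|h|. -/
theorem IsInnerIntegralAt.unique {b : Module.Basis (Fin n) ℂ (Module.End ℂ F)} {q : ℕ}
    {α : LieForm m F E (q + n)} {η η' : BaseEndForm m F E q} (h : IsInnerIntegralAt b α η x)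
    (h' : IsInnerIntegralAt b α η' x) (X : Fin q → VectorFields m M) :
    fibreEnd (η X) x = fibreEnd (η' X) x := by
  obtain ⟨ψ, h1, hψ⟩ := exists_cutoff (m := m) x ((trivializationAt F E x).open_baseSet.mem_nhds
    (FiberBundle.mem_baseSet_trivializationAt F E x))
  have hx : ψ x = 1 := h1.self_of_nhds
  have h2 := (h _ (mem_baseSet_of_cutoff hψ hx) (fun i => flatLift _ ψ hψ (X i))
    (fun j => cutoffEnd _ ψ hψ (b j))).symm.trans (h' _ (mem_baseSet_of_cutoff hψ hx) _ _)
  rw [innerVolume_cutoffEnd hψ b hx] at h2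
  have h3 := smul_right_injective _ (volumeFactor_ne_zero b) h2
  have hx2 : (ψ * ψ) x = 1 := by
    change ψ x * ψ x = 1
    rw [hx, one_mul]
  have h4 : ∀ ζ : BaseEndForm m F E q, fibreEnd (ζ fun i => DerAlgebroid.symbol m F E
      (flatLift _ ψ hψ (X i))) x = fibreEnd (ζ X) x := by
    intro ζ
    obtain ⟨g, hg, hg'⟩ := map_smul_of_eq_one ζ (ψ * ψ) hx2 X
    simp only [symbol_flatLift]
    rw [hg', fibreEnd_smul, hg, one_smul]
  rwa [h4, h4] at h3

theorem exists_isInnerIntegral (b : Module.Basis (Fin n) ℂ (Module.End ℂ F)) {q : ℕ}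
    (α : LieForm m F E (q + n)) : ∃ η, IsInnerIntegral b α η := by
  have hloc : ∀ x : M, ∃ η : BaseEndForm m F E q, ∀ᶠ y in nhds x, IsInnerIntegralAt b α η y := by
    intro x
    obtain ⟨ψ, h1, hψ⟩ := exists_cutoff (m := m) x
      ((trivializationAt F E x).open_baseSet.mem_nhds
        (FiberBundle.mem_baseSet_trivializationAt F E x))
    refine ⟨localInnerIntegral hψ b α, ?_⟩
    filter_upwards [h1] with y hy
    exact isInnerIntegralAt_localInnerIntegral hψ b α hy
  choose η hη using hloc
  -- The glued value at x is that of the local factor chosen for x. Near x it agrees with this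
  -- single factor by pointwise uniqueness, hence is smooth.
  have hglue : ∀ X : Fin q → VectorFields m M, ∃ a : EndSections m F E, ∀ x,
      fibreEnd a x = fibreEnd (η x X) x := fun X =>
    exists_endSections_of_local _ fun x => ⟨η x X, by
      filter_upwards [hη x] with y hy
      exact hy.unique (hη y).self_of_nhds X⟩
  choose ζ hζ using hglue
  let ζ' : BaseEndForm m F E q :=
    { toFun := ζ
      map_update_add' := by
        intro d X i Y Y'
        obtain rfl : d = instDecidableEqFin q := Subsingleton.elim _ _
        refine endSections_ext fun x => ?_
        rw [fibreEnd_add, hζ, hζ, hζ, AlternatingMap.map_update_add, fibreEnd_add]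
      map_update_smul' := by
        intro d X i f Y
        obtain rfl : d = instDecidableEqFin q := Subsingleton.elim _ _
        refine endSections_ext fun x => ?_
        rw [fibreEnd_smul, hζ, hζ, AlternatingMap.map_update_smul, fibreEnd_smul]
      map_eq_zero_of_eq' := by
        intro X i j h hij
        refine endSections_ext fun x => ?_
        rw [hζ, AlternatingMap.map_eq_zero_of_eq _ X h hij] }
  refine ⟨ζ', (isInnerIntegral_iff b α ζ').2 fun x e _ hx D a => ?_⟩
  change _ = _ • fibreEnd (ζ _) x
  rw [hζ]
  exact (hη x).self_of_nhds e hx D a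

theorem existsUnique_isInnerIntegral (b : Module.Basis (Fin n) ℂ (Module.End ℂ F)) {q : ℕ}
    (α : LieForm m F E (q + n)) : ∃! η, IsInnerIntegral b α η := by
  obtain ⟨η, hη⟩ := exists_isInnerIntegral b α
  refine ⟨η, hη, fun η' hη' => ?_⟩
  ext1 X
  exact endSections_ext fun x => ((isInnerIntegral_iff b α η').1 hη' x).unique
    ((isInnerIntegral_iff b α η).1 hη x) X

theorem isInnerIntegral_innerIntegral (b : Module.Basis (Fin n) ℂ (Module.End ℂ F)) {q : ℕ}
    (α : LieForm m F E (q + n)) : IsInnerIntegral b α (innerIntegral b α) :=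
  Classical.epsilon_spec (exists_isInnerIntegral b α)

end InnerIntegralExistence

/-! ### Traced inner integration commutes with the differentials -/

noncomputable section Stokes

set_option linter.unusedSectionVars false

variable {m : ℕ} {M : Type*} [TopologicalSpace M] [ChartedSpace (EuclideanSpace ℝ (Fin m)) M]
  [IsManifold (𝓡 m) ∞ M] [T2Space M]
  {F : Type*} [NormedAddCommGroup F] [NormedSpace ℂ F] [FiniteDimensional ℂ F] {E : M → Type*}
  [TopologicalSpace (TotalSpace F E)] [∀ x, TopologicalSpace (E x)]
  [∀ x, AddCommGroup (E x)] [∀ x, Module ℂ (E x)] [FiberBundle F E] [VectorBundle ℂ F E]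
  [ContMDiffVectorBundle ∞ F E (𝓡 m)] {n : ℕ}

theorem DerAlgebroid.inclusion_lie_eq (a c : EndSections m F E) :
    ⁅DerAlgebroid.inclusion m F E a, c⁆ = a * c - c * a := rfl

/-- A(E) acts by commutators, which are traceless. This is why the trace must be taken before the
differentials commute. -/
theorem traceMap_inclusion_lie (a c : EndSections m F E) :
    traceMap m F E ⁅DerAlgebroid.inclusion m F E a, c⁆ = 0 := by
  ext x
  rw [DerAlgebroid.inclusion_lie_eq, traceMap_apply, fibreEnd_sub, fibreEnd_mul, fibreEnd_mul,
    map_sub, LinearMap.trace_mul_comm, sub_self]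
  rfl

theorem Fin.comp_eq_cons {A B : Type*} {q : ℕ} (g : A → B) (X : Fin (q + 1) → A) :
    (fun i => g (X i)) = Fin.cons (g (X 0)) fun i => g (X i.succ) := by
  funext l
  refine Fin.cases ?_ (fun l => ?_) l <;> rfl

/-- The degree is a variable k with a proof of k = q + n, because q + 1 + n and q + n + 1 are not
definitionally equal. -/
theorem appendArgs_cons {q k : ℕ} (h : k = q + n) (h' : k + 1 = q + 1 + n)
    (d : DerAlgebroid m F E) (D : Fin q → DerAlgebroid m F E) (a : Fin n → EndSections m F E) :
    appendArgs h' (Fin.cons d D) a = Fin.cons d (appendArgs h D a) := by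
  subst h
  rw [appendArgs, Fin.append_cons]
  rfl

theorem appendArgs_zero (h : n = 0 + n) (D : Fin 0 → DerAlgebroid m F E)
    (a : Fin n → EndSections m F E) :
    appendArgs h D a = fun j => DerAlgebroid.inclusion m F E (a j) := by
  funext j
  rw [← appendArgs_right h D a j]
  congr 1
  ext
  simp

variable {e : Trivialization F (TotalSpace.proj : TotalSpace F E → M)} [MemTrivializationAtlas e]
  {ψ : SmoothFun m M} (hψ : tsupport ψ ⊆ e.baseSet) {x : M}

/-- With all arguments in A(E), the action terms of the Koszul formula are commutators and have
trace zero. At x the bracket terms are those of the Chevalley–Eilenberg differential into top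
degree, zero by unimodularity. -/
theorem traceMap_koszul_cutoffEnd_eq_zero (b : Module.Basis (Fin (n + 1)) ℂ (Module.End ℂ F))
    (hx : ψ x = 1) {k : ℕ} (h : k + 1 = 0 + (n + 1)) (α : LieForm m F E k)
    (D : Fin 0 → DerAlgebroid m F E) :
    traceMap m F E (koszul α (appendArgs h D fun j => cutoffEnd e ψ hψ (b j))) x = 0 := by
  obtain rfl : k = n := by omega
  rw [appendArgs_zero]
  set a : Fin (k + 1) → EndSections m F E := fun j => cutoffEnd e ψ hψ (b j) with ha
  set Φ := α.compLinearMap (DerAlgebroid.inclusion m F E)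
  -- At x the constant frame multiplies like the matrices, so its brackets are again constant
  -- endomorphisms.
  have hcomm : ∀ i j, fibreEnd (a i * a j - a j * a i) x =
      fibreEnd (cutoffEnd e ψ hψ (b i * b j - b j * b i)) x := by
    intro i j
    rw [fibreEnd_sub, fibreEnd_mul, fibreEnd_mul, ha]
    simp only [fibreEnd_cutoffEnd_of_eq_one e ψ hψ _ hx, map_sub]
    have h3 := fun A B : Module.End ℂ F =>
      LinearEquiv.conj_comp (e.linearEquivAt ℂ x (mem_baseSet_of_cutoff hψ hx)).symm A B
    congr 1 <;> exact (h3 _ _).symm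
  have hterm : ∀ i j : Fin (k + 1), traceMap m F E (α (i.removeNth (Function.update
      (fun j => DerAlgebroid.inclusion m F E (a j)) j
        ⁅DerAlgebroid.inclusion m F E (a i), DerAlgebroid.inclusion m F E (a j)⁆))) x =
      ((LinearMap.trace ℂ (E x)).compAlternatingMap (pointForm hψ x Φ))
        (i.removeNth (Function.update b j (b i * b j - b j * b i))) := by
    intro i j
    rw [← DerAlgebroid.inclusion_lie, DerAlgebroid.inclusion_lie_eq, traceMap_apply]
    have h1 : α (i.removeNth (Function.update (fun j => DerAlgebroid.inclusion m F E (a j)) j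
        (DerAlgebroid.inclusion m F E (a i * a j - a j * a i)))) =
        Φ (i.removeNth (Function.update a j (a i * a j - a j * a i))) := by
      change _ = α _
      congr 1
      funext l
      simp only [Fin.removeNth, Function.update_apply]
      split_ifs <;> rfl
    rw [h1]
    change _ = LinearMap.trace ℂ (E x) (pointForm hψ x Φ _)
    rw [pointForm_apply]
    congr 1
    refine fibreEnd_map_congr Φ fun l => ?_
    simp only [Fin.removeNth, Function.update_apply, Function.comp_apply]
    split_ifs
    · exact hcomm i j
    · rfl
  have hsum := sum_map_removeNth_update_lie_eq_zero b (trace_mulLeft_eq_trace_mulRight b)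
    ((LinearMap.trace ℂ (E x)).compAlternatingMap (pointForm hψ x Φ))
  simp only [← hterm] at hsum
  rw [koszul, map_sum, SmoothFun.sum_apply]
  have hi : ∀ (i : ℕ) (f : SmoothFun m M), ((-1 : ℤ) ^ i • f) x = (-1 : ℤ) ^ i • f x := fun i f =>
    map_zsmul (ContMDiffMap.evalRingHom (I := 𝓡 m) (n := ∞) (I' := 𝓘(ℝ, ℂ)) (R := ℂ) x) _ f
  simp only [map_zsmul, map_sub, traceMap_inclusion_lie, zero_sub, map_sum, smul_neg]
  rw [← neg_eq_zero, ← Finset.sum_neg_distrib, ← hsum]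
  refine Finset.sum_congr rfl fun i _ => ?_
  rw [ContMDiffMap.coe_neg, Pi.neg_apply, neg_neg, hi, SmoothFun.sum_apply]

/-- The trace of an `A(E)`-valued form on `Γ(TM)`. -/
abbrev BaseEndForm.trace {q : ℕ} (η : BaseEndForm m F E q) : BaseForm m M q :=
  (traceMap m F E).compAlternatingMap η

/-- Near `x`, the form `η` is the factor of the inner volume form in `α`, tested on a flat frame. -/
def IsLocalFactor (b : Module.Basis (Fin n) ℂ (Module.End ℂ F)) (x : M) {q k : ℕ} (h : k = q + n)
    (α : LieForm m F E k) (η : BaseEndForm m F E q) : Prop :=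
  ∀ D : Fin q → DerAlgebroid m F E, ∀ᶠ y in nhds x,
    fibreEnd (α (appendArgs h D fun j => cutoffEnd e ψ hψ (b j))) y =
      volumeFactor b • fibreEnd (η fun i => DerAlgebroid.symbol m F E (D i)) y

theorem IsLocalFactor.trace {b : Module.Basis (Fin n) ℂ (Module.End ℂ F)} {q k : ℕ}
    {h : k = q + n} {α : LieForm m F E k} {η : BaseEndForm m F E q}
    (hη : IsLocalFactor hψ b x h α η) (D : Fin q → DerAlgebroid m F E) :
    ∀ᶠ y in nhds x,
      traceMap m F E (α (appendArgs h D fun j => cutoffEnd e ψ hψ (b j))) y =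
        (constFun m M (volumeFactor b) *
          η.trace fun i => DerAlgebroid.symbol m F E (D i)) y := by
  filter_upwards [hη D] with y hy
  rw [traceMap_apply, hy, map_smul]
  rfl

/-- Cartan's formula for contraction with a flat lift: the Lie derivative of α passes to the trace
of η, and the contracted form is left for induction. -/
theorem traceMap_koszul_cons (b : Module.Basis (Fin n) ℂ (Module.End ℂ F))
    (h1 : ∀ᶠ y in nhds x, ψ y = 1) {q k : ℕ} (h : k + 1 = q + n) (h' : k + 1 + 1 = q + 1 + n)
    {α : LieForm m F E (k + 1)} {η : BaseEndForm m F E q} (hη : IsLocalFactor hψ b x h α η)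
    (Y : VectorFields m M) (D : Fin q → DerAlgebroid m F E) :
    traceMap m F E (koszul α (appendArgs h' (Fin.cons (flatLift e ψ hψ Y) D)
        fun j => cutoffEnd e ψ hψ (b j))) x =
      volumeFactor b * (DerAlgebroid.symbol m F E (flatLift e ψ hψ Y)
          (η.trace fun i => DerAlgebroid.symbol m F E (D i)) x -
        ∑ i, η.trace (Function.update (fun i => DerAlgebroid.symbol m F E (D i)) i
          ⁅DerAlgebroid.symbol m F E (flatLift e ψ hψ Y), DerAlgebroid.symbol m F E (D i)⁆) x) -
      traceMap m F E (koszul (α.curryLeft (flatLift e ψ hψ Y))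
        (appendArgs h D fun j => cutoffEnd e ψ hψ (b j))) x := by
  have hx := h1.self_of_nhds
  set d := flatLift e ψ hψ Y with hd
  set a : Fin n → EndSections m F E := fun j => cutoffEnd e ψ hψ (b j) with ha
  have hsub : ∀ f g : SmoothFun m M, (f - g) x = f x - g x := fun f g => rfl
  rw [appendArgs_cons h h', koszul_cons, map_sub, map_sub, hsub, hsub, mul_sub]
  congr 2
  -- The factorization holds on a neighbourhood of x, so Y may differentiate it; √|h| is constant,
  -- and ψ²Y agrees with Y at x.
  · rw [hd, traceMap_lie_flatLift hψ h1, Y.apply_congr (hη.trace hψ D), Derivation.leibniz,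
      Y.apply_constFun, smul_zero, add_zero, symbol_flatLift]
    change volumeFactor b * _ = volumeFactor b * ((ψ x * ψ x) * _)
    rw [hx, one_mul, one_mul]
    rfl
  · have hAd : koszulAd α d (appendArgs h D a) =
        ∑ i : Fin q, α (appendArgs h (Function.update D i ⁅d, D i⁆) a) +
          ∑ j : Fin n, α (Function.update (appendArgs h D a) (Fin.cast h.symm (Fin.natAdd q j))
            (DerAlgebroid.inclusion m F E ⁅d, a j⁆)) := by
      change ∑ l, α (Function.update (appendArgs h D a) l ⁅d, appendArgs h D a l⁆) = _
      rw [← Equiv.sum_comp (finCongr h.symm), Fin.sum_univ_add]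
      simp only [finCongr_apply, appendArgs_left, appendArgs_right, appendArgs_update_left,
        DerAlgebroid.inclusion_lie]
    rw [hAd, map_add, map_sum, map_sum, Finset.mul_sum]
    change (_ : SmoothFun m M) x + (_ : SmoothFun m M) x = _
    rw [SmoothFun.sum_apply, SmoothFun.sum_apply]
    -- The bracket of the flat lift with the constant frame vanishes at x, so only brackets among
    -- the D_i contribute.
    have h2 : ∀ j : Fin n, traceMap m F E (α (Function.update (appendArgs h D a)
        (Fin.cast h.symm (Fin.natAdd q j)) (DerAlgebroid.inclusion m F E ⁅d, a j⁆))) x = 0 := by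
      intro j
      rw [traceMap_apply, fibreEnd_map_update_inclusion_eq_zero α _ _
        (fibreEnd_lie_flatLift_cutoffEnd hψ h1 Y (b j)), map_zero]
    rw [Finset.sum_eq_zero (s := (Finset.univ : Finset (Fin n))) fun j _ => h2 j, add_zero]
    refine Finset.sum_congr rfl fun i _ => ?_
    rw [(hη.trace hψ _).self_of_nhds]
    change volumeFactor b * η.trace _ x = _
    congr 3
    funext l
    simp only [Function.update_apply]
    split_ifs <;> rfl

/-- The arguments from A(E) stand last, so contraction in front produces no sign. -/
theorem IsLocalFactor.curryLeft {b : Module.Basis (Fin n) ℂ (Module.End ℂ F)} {q k : ℕ}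
    {h : k + 1 = q + 1 + n} {α : LieForm m F E (k + 1)} {η : BaseEndForm m F E (q + 1)}
    (hη : IsLocalFactor hψ b x h α η) (h' : k = q + n) (d : DerAlgebroid m F E) :
    IsLocalFactor hψ b x h' (α.curryLeft d) (η.curryLeft (DerAlgebroid.symbol m F E d)) := by
  intro D
  filter_upwards [hη (Fin.cons d D)] with y hy
  rw [appendArgs_cons h'] at hy
  refine hy.trans ?_
  rw [Fin.comp_eq_cons (DerAlgebroid.symbol m F E) (Fin.cons d D)]
  rfl

/-- Induction on q: both Koszul differentials obey Cartan's formula, the Lie derivative terms match,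
and contraction lowers q. At q = 0 the contracted form on A(E) contributes nothing, by
unimodularity. -/
theorem traceMap_koszul_flatLift (b : Module.Basis (Fin (n + 1)) ℂ (Module.End ℂ F))
    (h1 : ∀ᶠ y in nhds x, ψ y = 1) (q : ℕ) : ∀ {k : ℕ} (h : k = q + (n + 1))
    (h' : k + 1 = q + 1 + (n + 1)) {α : LieForm m F E k} {η : BaseEndForm m F E q}
    (_ : IsLocalFactor hψ b x h α η) (X : Fin (q + 1) → VectorFields m M),
    traceMap m F E (koszul α (appendArgs h' (fun i => flatLift e ψ hψ (X i))
        fun j => cutoffEnd e ψ hψ (b j))) x =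
      volumeFactor b * koszul η.trace
        (fun i => DerAlgebroid.symbol m F E (flatLift e ψ hψ (X i))) x := by
  induction q with
  | zero =>
    intro k h h' α η hη X
    -- Since the basis is nonempty, α has positive degree and can be contracted.
    obtain ⟨k, rfl⟩ : ∃ k', k = k' + 1 := ⟨n, by omega⟩
    rw [Fin.comp_eq_cons (flatLift e ψ hψ) X, traceMap_koszul_cons hψ b h1 h h' hη,
      traceMap_koszul_cutoffEnd_eq_zero hψ b h1.self_of_nhds h, sub_zero]
    congr 1
    rw [koszul, Fin.sum_univ_one, Finset.univ_eq_empty, Finset.sum_empty, sub_zero]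
    simp only [Fin.val_zero, pow_zero, one_smul]
    have h3 : Finset.Ioi (0 : Fin (0 + 1)) = ∅ := rfl
    rw [h3, Finset.sum_empty, sub_zero]
    congr 3
  | succ q ih =>
    intro k h h' α η hη X
    obtain ⟨k, rfl⟩ : ∃ k', k = k' + 1 := ⟨q + (n + 1), by omega⟩
    have h2 : k = q + (n + 1) := by omega
    rw [Fin.comp_eq_cons (flatLift e ψ hψ) X, traceMap_koszul_cons hψ b h1 h h' hη,
      ih h2 h (hη.curryLeft hψ h2 _) fun i => X i.succ, ← mul_sub]
    have hX : (fun i => DerAlgebroid.symbol m F E (flatLift e ψ hψ (X i))) =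
        Fin.cons (DerAlgebroid.symbol m F E (flatLift e ψ hψ (X 0)))
          fun i => DerAlgebroid.symbol m F E (flatLift e ψ hψ (X i.succ)) :=
      Fin.comp_eq_cons (fun Y => DerAlgebroid.symbol m F E (flatLift e ψ hψ Y)) X
    rw [hX, koszul_cons]
    congr 1
    have hsub : ∀ f g : SmoothFun m M, (f - g) x = f x - g x := fun f g => rfl
    rw [hsub, hsub, ← SmoothFun.sum_apply]
    rfl

theorem innerIntegral_isLocalFactor (b : Module.Basis (Fin n) ℂ (Module.End ℂ F))
    (h1 : ∀ᶠ y in nhds x, ψ y = 1) (α : ∀ k, LieForm m F E k) {q k : ℕ} (h : k = q + n) :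
    IsLocalFactor hψ b x h (α k) (innerIntegral b (α (q + n))) := by
  subst h
  intro D
  filter_upwards [h1] with y hy
  rw [← innerVolume_cutoffEnd hψ b hy]
  exact (isInnerIntegral_iff b _ _).1 (isInnerIntegral_innerIntegral b (α (q + n))) y e (mem_baseSet_of_cutoff hψ hy) D _

/-- An empty basis means rank zero, where A(E) has zero fibres. This case is separate because the
induction contracts forms of positive degree. -/
theorem traceMap_eq_zero_of_basis (b : Module.Basis (Fin 0) ℂ (Module.End ℂ F))
    (a : EndSections m F E) : traceMap m F E a = 0 := by
  ext x
  have : Subsingleton (Module.End ℂ (E x)) := (fibreBasis b (trivializationAt F E x) x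
    (FiberBundle.mem_baseSet_trivializationAt F E x)).repr.injective.subsingleton
  rw [traceMap_apply, Subsingleton.elim (fibreEnd a x) 0, map_zero]
  rfl

theorem traceInnerIntegral_gradedDifferential (b : Module.Basis (Fin n) ℂ (Module.End ℂ F))
    (α : ∀ k, LieForm m F E k) :
    traceInnerIntegral b (gradedDifferential α) = gradedDifferential (traceInnerIntegral b α) := by
  obtain _ | n := n
  · have h0 : ∀ (α : ∀ k, LieForm m F E k) q, traceInnerIntegral b α q = 0 := fun α q => by
      ext1 X
      exact traceMap_eq_zero_of_basis b _
    funext q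
    rw [h0]
    obtain _ | q := q
    · rfl
    · ext1 X
      change 0 = koszul (traceInnerIntegral b α q) X
      rw [h0]
      simp [koszul]
  · funext q
    ext X x
    obtain ⟨ψ, h1, hψ⟩ := exists_cutoff (m := m) x
      ((trivializationAt F E x).open_baseSet.mem_nhds
        (FiberBundle.mem_baseSet_trivializationAt F E x))
    set e := trivializationAt F E x
    have hx : ψ x = 1 := h1.self_of_nhds
    have hx2 : (ψ * ψ) x = 1 := by
      change ψ x * ψ x = 1
      rw [hx, one_mul]
    -- Both sides may be tested on symbols of flat lifts, where the local factorization applies.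
    have hred : ∀ β : BaseForm m M q, β X x =
        β (fun i => DerAlgebroid.symbol m F E (flatLift e ψ hψ (X i))) x := by
      intro β
      obtain ⟨g, hg, hg'⟩ := map_smul_of_eq_one β (ψ * ψ) hx2 X
      simp only [symbol_flatLift]
      rw [hg']
      change _ = g x * _
      rw [hg, one_mul]
    rw [hred, hred]
    have hloc := ((innerIntegral_isLocalFactor hψ b h1 (gradedDifferential α) (q := q) rfl).trace hψ
      fun i => flatLift e ψ hψ (X i)).self_of_nhds
    refine mul_left_cancel₀ (volumeFactor_ne_zero b) (hloc.symm.trans ?_)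
    obtain _ | q := q
    -- Degree zero on the base: all arguments lie in A(E), and the right side is zero by the
    -- definition of `gradedDifferential`.
    · refine (traceMap_koszul_cutoffEnd_eq_zero hψ b hx (k := 0 + n) rfl (α (0 + n)) _).trans ?_
      exact (mul_zero _).symm
    -- The degree q + 1 + n of the form being differentiated is read as q + (n + 1).
    · exact traceMap_koszul_flatLift hψ b h1 q (k := q + 1 + n) (by omega) rfl
        (innerIntegral_isLocalFactor hψ b h1 α (by omega)) X

end Stokes

theorem mainTheorem12 {m : ℕ} {M : Type*} [TopologicalSpace M]
    [ChartedSpace (EuclideanSpace ℝ (Fin m)) M] [IsManifold (𝓡 m) ∞ M]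
    [T2Space M] [SecondCountableTopology M]
    {F : Type*} [NormedAddCommGroup F] [NormedSpace ℂ F] [FiniteDimensional ℂ F]
    {E : M → Type*} [TopologicalSpace (TotalSpace F E)] [∀ x, TopologicalSpace (E x)]
    [∀ x, AddCommGroup (E x)] [∀ x, Module ℂ (E x)]
    [FiberBundle F E] [VectorBundle ℂ F E] [ContMDiffVectorBundle ∞ F E (𝓡 m)]
    {n : ℕ} (b : Module.Basis (Fin n) ℂ (Module.End ℂ F)) :
    (∀ (q : ℕ) (α : LieForm m F E (q + n)), ∃! η : BaseEndForm m F E q, IsInnerIntegral b α η) ∧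
    ∀ α : (∀ k, LieForm m F E k),
      traceInnerIntegral b (gradedDifferential α) = gradedDifferential (traceInnerIntegral b α) := by
  exact ⟨fun q α => existsUnique_isInnerIntegral b α, traceInnerIntegral_gradedDifferential b⟩
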